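/- A zero-dimensional system $(X,f)$ is a compact metrizable zero-dimensional space $X$ with a homeomorphism $f\colon X\to X$. A *basic set* of $(X,f)$ is a closed set $A\subseteq X$ such that every clopen set $U\supseteq A$ satisfies $U\cap\omega(x)\neq\emptyset$ for all $x\in X$ (where $\omega(x)$ is the $\omega$-limit set of $x$), and such that $|A\cap\{f^i(x):i\in\mathbb Z\}|\le 1$ for all $x\in X$; a *minimal basic set* is one that is minimal with respect to inclusion among basic sets. Let $(V,E,\ge)$ be an ordered Bratteli diagram: $V=V_0\sqcup V_1\sqcup\cdots$ and $E=E_1\sqcup E_2\sqcup\cdots$ with finite non-empty levels, $V_0$ a single point, source and range maps $s\colon E_n\to V_{n-1}$ and $r\colon E_n\to V_n$ that are surjective for every $n$, and a partial order on $E$ in which two edges are comparable if and only if they have the same range. Let $E_{0,\infty}$ be the space of infinite paths starting in $V_0$, with the topology induced by the product topology, partially ordered by $p<q$ if and only if for some $k$ one has $p_k<q_k$ and $p_l=q_l$ for all $l>k$. Let $E_{0,\infty,\min}$ and $E_{0,\infty,\max}$ be the sets of paths all of whose edges are minimal, respectively maximal. The Vershik map sends $p\in E_{0,\infty}\setminus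 E_{0,\infty,\max}$ to the least path greater than $p$. A *Bratteli–Vershik model* $(V,E,\ge,\psi)$ is an ordered Bratteli diagram with a homeomorphism $\psi$ of $E_{0,\infty}$ that extends the Vershik map and maps $E_{0,\infty,\max}$ into $E_{0,\infty,\min}$; it is a model of $(X,f)$ if $(E_{0,\infty},\psi)$ is topologically conjugate to $(X,f)$. The diagram (or the model) is *decisive* if the Vershik map extends in exactly one way to a homeomorphism of $E_{0,\infty}$. A zero-dimensional system is *Bratteli–Vershikizable* if it is topologically conjugate to $(E_{0,\infty},\psi)$ for some decisive ordered Bratteli diagram with its unique extension $\psi$. A model $(V,E,\ge,\psi)$ has the *closing property* if for every $n\ge 0$ and every infinite path $(e_{n+1},e_{n+2},\dots)$ starting in $V_n$ with $|r^{-1}(r(e_i))|=1$ for all $i>n$, the set of all paths in $E_{0,\infty}$ that pass through all the vertices $s(e_m)$, $m>n$, is a periodic orbit of $\psi$ of least period $l(s(e_{n+1}))$, where $l(v)$ is the number of finite paths from $V_0$ to $v$. **Statement.** Let $(X,f)$ be a Bratteli–Vershikizable zero-dimensional system. Then there exist a decisive Bratteli–Vershik model $(V,E,\ge,\psi)$ with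 the closing property, a topological conjugacy $\varphi\colon(X,f)\to(E_{0,\infty},\psi)$, and a minimal basic set $B$ of $(X,f)$ such that $\varphi(B)=E_{0,\infty,\min}$. -/

import Mathlib

open Set Filter Topology

/-! ## Zero-dimensional systems: sections, quasi-sections, basic sets -/

section Systems

variable {X : Type*} [TopologicalSpace X]

/-- The two-sided orbit `O(x) = {fⁱ(x) | i ∈ ℤ}`. -/
def fullOrbit (f : X ≃ₜ X) (x : X) : Set X :=
  Set.range fun i : ℤ => (f ^ i) x

/-- The `ω`-limit set `ω(x)` of a point: the set of accumulation points of its forward orbit. -/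
def omegaLimitPoint (f : X ≃ₜ X) (x : X) : Set X :=
  omegaLimit atTop (fun (n : ℕ) (y : X) => f^[n] y) {x}

/-- A clopen set is a complete section if every `ω`-limit set intersects it. -/
def IsCompleteSection (f : X ≃ₜ X) (U : Set X) : Prop :=
  IsClopen U ∧ ∀ x, (omegaLimitPoint f x ∩ U).Nonempty

/-- A closed set is a quasi-section if each clopen set containing it is a complete section. -/
def IsQuasiSection (f : X ≃ₜ X) (A : Set X) : Prop :=
  IsClosed A ∧ ∀ U, IsClopen U → A ⊆ U → IsCompleteSection f U

/-- A basic set is a quasi-section that every orbit enters at most once. -/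
def IsBasicSet (f : X ≃ₜ X) (A : Set X) : Prop :=
  IsQuasiSection f A ∧ ∀ x, (fullOrbit f x ∩ A).encard ≤ 1

/-- A basic set that is minimal with respect to inclusion among basic sets. -/
def IsMinimalBasicSet (f : X ≃ₜ X) (A : Set X) : Prop :=
  Minimal (IsBasicSet f) A

/-- `S` is a periodic orbit of `f` of least period `l` (here `l` is positive, since `x` is a
periodic point). -/
def IsPeriodicOrbit (f : X ≃ₜ X) (S : Set X) (l : ℕ) : Prop :=
  ∃ x ∈ Function.periodicPts f, Function.minimalPeriod f x = l ∧ S = fullOrbit f x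

end Systems

/-! ## Ordered Bratteli diagrams -/

/-- A Bratteli diagram. `V n` is the `n`-th vertex set, and `E n` is the set of edges from `V n` to
`V (n + 1)` (written `E_{n+1}` in the usual indexing). -/
structure BratteliDiagram where
  V : ℕ → Type
  E : ℕ → Type
  /-- The source map. -/
  s : ∀ {n}, E n → V n
  /-- The range map. -/
  r : ∀ {n}, E n → V (n + 1)
  finite_V : ∀ n, Finite (V n)
  nonempty_V : ∀ n, Nonempty (V n)
  finite_E : ∀ n, Finite (E n)
  nonempty_E : ∀ n, Nonempty (E n)
  /-- `V 0` is a single point. -/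
  subsingleton_V_zero : Subsingleton (V 0)
  s_surjective : ∀ n, Function.Surjective (s (n := n))
  r_surjective : ∀ n, Function.Surjective (r (n := n))

/-- An ordered Bratteli diagram: the edges carry a partial order for which two edges are comparable
if and only if they have the same range. -/
structure OrderedBratteliDiagram extends BratteliDiagram where
  order : ∀ n, PartialOrder (E n)
  comparable_iff : ∀ {n} (e e' : E n), (e ≤ e' ∨ e' ≤ e) ↔ r e = r e'

namespace BratteliDiagram

variable (D : BratteliDiagram)

/-- The finite edge sets carry the discrete topology. -/
instance (n : ℕ) : TopologicalSpace (D.E n) := ⊥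

instance (n : ℕ) : DiscreteTopology (D.E n) := ⟨rfl⟩

/-- The space `E_{0,∞}` of infinite paths starting at the top vertex, with the topology induced by
the product topology. -/
abbrev PathSpace : Type := {p : ∀ n, D.E n // ∀ n, D.r (p n) = D.s (p (n + 1))}

/-- The set `E_{n,∞}` of infinite paths starting in `V n`; `c k` is the edge from level `n + k` to
level `n + k + 1`. -/
abbrev TailPath (n : ℕ) : Type :=
  {c : ∀ k, D.E (n + k) // ∀ k, D.r (c k) = D.s (c (k + 1))}

/-- The set `P(v)` of finite paths from the top vertex to `v`. For `v ∈ V 0` it consists of the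
empty path; for `v ∈ V (n + 1)` such a path is an edge `e` with `r(e) = v` preceded by a path to
`s(e)`. -/
def FinPath : (n : ℕ) → D.V n → Type
  | 0, _ => Unit
  | n + 1, v => Σ e : {e : D.E n // D.r e = v}, FinPath n (D.s e.1)

theorem finite_finPath : ∀ (n : ℕ) (v : D.V n), Finite (D.FinPath n v)
  | 0, _ => inferInstanceAs (Finite Unit)
  | n + 1, v => by
    have := D.finite_E n
    have := fun w => finite_finPath n w
    exact inferInstanceAs
      (Finite (Σ e : {e : D.E n // D.r e = v}, D.FinPath n (D.s e.1)))

/-- The height `l(v) = |P(v)|`. -/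
noncomputable def height {n : ℕ} (v : D.V n) : ℕ := Nat.card (D.FinPath n v)

/-- The tower of a vertex `v`: the set of all infinite paths (from the top vertex) through `v`. -/
def tower {n : ℕ} (v : D.V n) : Set D.PathSpace := {p | D.s (p.1 n) = v}

/-- A path is constant if each of its edges is the only edge with its range. -/
def IsConstantPath {n : ℕ} (c : D.TailPath n) : Prop :=
  ∀ k, (D.r ⁻¹' {D.r (c.1 k)}).encard = 1

/-- The closing property of `(V, E, ψ)`: for every constant path `c` from level `n`, the paths
passing through all vertices of `c` form a periodic orbit of least period `l(s(c 0))`. -/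
def HasClosingProperty (ψ : D.PathSpace ≃ₜ D.PathSpace) : Prop :=
  ∀ (n : ℕ) (c : D.TailPath n), D.IsConstantPath c →
    IsPeriodicOrbit ψ (⋂ k, D.tower (D.s (c.1 k))) (D.height (D.s (c.1 0)))

end BratteliDiagram

namespace OrderedBratteliDiagram

variable (D : OrderedBratteliDiagram)

instance (n : ℕ) : PartialOrder (D.E n) := D.order n

/-- The set `E_{0,∞,min}` of infinite paths all of whose edges are minimal. -/
def minPaths : Set D.PathSpace := {p | ∀ n, IsMin (p.1 n)}

/-- The set `E_{0,∞,max}` of infinite paths all of whose edges are maximal. -/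
def maxPaths : Set D.PathSpace := {p | ∀ n, IsMax (p.1 n)}

/-- The (strict) lexicographic order on infinite paths: `p < q` if they are cofinal and the last
edges at which they differ satisfy `p k < q k`. -/
def LexLT (p q : D.PathSpace) : Prop :=
  ∃ k, p.1 k < q.1 k ∧ ∀ l, k < l → p.1 l = q.1 l

/-- `q` is the least element above `p` in the lexicographic order. -/
def IsVershikSucc (p q : D.PathSpace) : Prop :=
  D.LexLT p q ∧ ∀ q', D.LexLT p q' → q = q' ∨ D.LexLT q q'

/-- The homeomorphism `ψ` prolongs the Vershik map `E_{0,∞} \ E_{0,∞,max} → E_{0,∞}`. -/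
def ExtendsVershikMap (ψ : D.PathSpace ≃ₜ D.PathSpace) : Prop :=
  ∀ p, p ∉ D.maxPaths → D.IsVershikSucc p (ψ p)

/-- `(V, E, ≥, ψ)` is a Bratteli–Vershik model. -/
def IsBratteliVershikModel (ψ : D.PathSpace ≃ₜ D.PathSpace) : Prop :=
  D.ExtendsVershikMap ψ ∧ MapsTo ψ D.maxPaths D.minPaths

/-- Decisiveness: the Vershik map prolongs in a unique way to a homeomorphism. -/
def IsDecisive : Prop :=
  ∃! ψ : D.PathSpace ≃ₜ D.PathSpace, D.ExtendsVershikMap ψ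

end OrderedBratteliDiagram

/-- `φ` is a topological conjugacy from `(X, f)` to `(Y, g)`. -/
def IsTopConjugacy {X Y : Type*} [TopologicalSpace X] [TopologicalSpace Y]
    (f : X ≃ₜ X) (g : Y ≃ₜ Y) (φ : X ≃ₜ Y) : Prop :=
  ∀ x, φ (f x) = g (φ x)

/-- `(X, f)` is Bratteli–Vershikizable: it is conjugate to the system of a decisive ordered Bratteli
diagram with its (unique) Vershik homeomorphism. -/
def IsBratteliVershikizable {X : Type*} [TopologicalSpace X] (f : X ≃ₜ X) : Prop :=
  ∃ (D : OrderedBratteliDiagram) (ψ : D.PathSpace ≃ₜ D.PathSpace) (φ : X ≃ₜ D.PathSpace),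
    D.IsDecisive ∧ D.ExtendsVershikMap ψ ∧ IsTopConjugacy f ψ φ

/-! ### Existence and minimality of basic sets -/

section BasicSets

variable {X : Type*} [TopologicalSpace X]

/-! Basic sets exist, and Zorn's lemma makes them minimal (`exists_isBasicSet`,
`IsBasicSet.exists_isMinimalBasicSet`). Kakutani–Rokhlin partitions over clopen sets shrinking to a
basic set B yield a Bratteli–Vershik model whose minimal paths correspond to B
(`TowerSystem.ofBases`); it has the closing property because no orbit meets B twice
(`TowerSystem.hasClosingProperty`). Only decisiveness needs more: maximal paths come from f⁻¹(B),
and homeomorphisms agreeing off a set with at most one interior point coincide, so it suffices that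
B has at most one interior point (`TowerSystem.isDecisive`).

The given decisive diagram supplies this for minimal B. Let M be the set of points whose paths there
are maximal. If M had two interior points, precomposing with a nontrivial homeomorphism supported in
the interior of M would give a second extension of the Vershik map. Moreover every periodic orbit
meets M, since the Vershik map strictly increases paths off the maximal ones. By minimality, each
nonempty open U inside B contains a periodic point, and nearby points that return to B after the
same time are periodic too. Baire category then gives a point of U whose orbit enters the interior
of M, a single point. Two interior points of B would thus give two points of B on one orbit
(`IsMinimalBasicSet.subsingleton_interior`). -/

theorem zpow_add_apply (f : X ≃ₜ X) (i j : ℤ) (x : X) : (f ^ (i + j)) x = (f ^ i) ((f ^ j) x) := by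
  rw [zpow_add, Homeomorph.mul_apply]

theorem zpow_neg_apply_self (f : X ≃ₜ X) (i : ℤ) (x : X) : (f ^ (-i)) ((f ^ i) x) = x := by
  rw [← zpow_add_apply]; simp

theorem iterate_eq_zpow (f : X ≃ₜ X) (n : ℕ) (x : X) : f^[n] x = (f ^ (n : ℤ)) x := by
  induction n with
  | zero => simp
  | succ n ih =>
    rw [Function.iterate_succ_apply', ih, Nat.cast_succ, add_comm, zpow_add_apply, zpow_one]

/-- Every orbit meets `U`. -/
def MeetsOrbits (f : X ≃ₜ X) (U : Set X) : Prop := ∀ x, ∃ i : ℤ, (f ^ i) x ∈ U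

/-- Finitely many translates of `U` cover the space. The uniform gap upgrades one visit per
two-sided orbit to infinitely many visits in both directions. -/
theorem MeetsOrbits.exists_bound [CompactSpace X] {f : X ≃ₜ X} {U : Set X} (hU : IsOpen U)
    (h : MeetsOrbits f U) : ∃ N : ℕ, ∀ x, ∃ i : ℤ, |i| ≤ N ∧ (f ^ i) x ∈ U := by
  obtain ⟨t, ht⟩ := isCompact_univ.elim_finite_subcover (fun i : ℤ => (f ^ i) ⁻¹' U)
    (fun i => hU.preimage (f ^ i).continuous)
    (fun x _ => by obtain ⟨i, hi⟩ := h x; exact mem_iUnion.2 ⟨i, hi⟩)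
  refine ⟨t.sup Int.natAbs, fun x => ?_⟩
  have := ht (mem_univ x)
  simp only [mem_iUnion, mem_preimage, exists_prop] at this
  obtain ⟨i, hi, hx⟩ := this
  refine ⟨i, ?_, hx⟩
  rw [Int.abs_eq_natAbs]
  exact_mod_cast Finset.le_sup (f := Int.natAbs) hi

theorem MeetsOrbits.exists_ge [CompactSpace X] {f : X ≃ₜ X} {U : Set X} (hU : IsOpen U)
    (h : MeetsOrbits f U) (x : X) (m : ℤ) : ∃ k, m ≤ k ∧ (f ^ k) x ∈ U := by
  obtain ⟨N, hN⟩ := h.exists_bound hU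
  obtain ⟨i, hi, hx⟩ := hN ((f ^ (m + N)) x)
  rw [← zpow_add_apply] at hx
  exact ⟨_, by have := abs_le.1 hi; omega, hx⟩

theorem MeetsOrbits.exists_le [CompactSpace X] {f : X ≃ₜ X} {U : Set X} (hU : IsOpen U)
    (h : MeetsOrbits f U) (x : X) (m : ℤ) : ∃ k, k ≤ m ∧ (f ^ k) x ∈ U := by
  obtain ⟨N, hN⟩ := h.exists_bound hU
  obtain ⟨i, hi, hx⟩ := hN ((f ^ (m - N)) x)
  rw [← zpow_add_apply] at hx
  exact ⟨_, by have := abs_le.1 hi; omega, hx⟩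

theorem mem_omegaLimitPoint_iff (f : X ≃ₜ X) (x z : X) :
    z ∈ omegaLimitPoint f x ↔ ∀ U ∈ 𝓝 z, ∀ m : ℕ, ∃ k, m ≤ k ∧ f^[k] x ∈ U := by
  rw [omegaLimitPoint, mem_omegaLimit_singleton_iff_mapClusterPt, mapClusterPt_iff_frequently]
  simp only [frequently_atTop]

theorem isClosed_omegaLimitPoint (f : X ≃ₜ X) (x : X) : IsClosed (omegaLimitPoint f x) :=
  isClosed_omegaLimit _ _ _

theorem MeetsOrbits.omegaLimitPoint_inter [CompactSpace X] {f : X ≃ₜ X} {U : Set X}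
    (hU : IsClopen U) (h : MeetsOrbits f U) (x : X) : (omegaLimitPoint f x ∩ U).Nonempty := by
  have : ∃ᶠ n : ℕ in atTop, f^[n] x ∈ U := by
    rw [frequently_atTop]
    intro m
    obtain ⟨k, hk, hx⟩ := h.exists_ge hU.isOpen x m
    lift k to ℕ using by omega
    exact ⟨k, by exact_mod_cast hk, by rwa [iterate_eq_zpow]⟩
  obtain ⟨z, hz, hc⟩ := hU.isClosed.isCompact.exists_mapClusterPt_of_frequently this
  exact ⟨z, (mem_omegaLimit_singleton_iff_mapClusterPt _ _ _ _).2 hc, hz⟩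

theorem meetsOrbits_of_omegaLimitPoint_inter {f : X ≃ₜ X} {U : Set X} (hU : IsOpen U)
    (h : ∀ x, (omegaLimitPoint f x ∩ U).Nonempty) : MeetsOrbits f U := by
  intro x
  obtain ⟨z, hz, hzU⟩ := h x
  obtain ⟨k, -, hk⟩ := (mem_omegaLimitPoint_iff f x z).1 hz U (hU.mem_nhds hzU) 0
  exact ⟨k, by rwa [← iterate_eq_zpow]⟩

/-- If the closed set `A` missed a closed `ω`-limit set, a clopen neighbourhood of `A` would miss it
as well; so the quantification over clopen neighbourhoods can be dropped. -/
theorem isBasicSet_iff [CompactSpace X] [T2Space X] [TotallyDisconnectedSpace X] (f : X ≃ₜ X)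
    (A : Set X) : IsBasicSet f A ↔ IsClosed A ∧ (∀ x, (omegaLimitPoint f x ∩ A).Nonempty) ∧
      ∀ x ∈ A, ∀ i : ℤ, (f ^ i) x ∈ A → (f ^ i) x = x := by
  have key : (∀ x, (fullOrbit f x ∩ A).encard ≤ 1) ↔
      ∀ x ∈ A, ∀ i : ℤ, (f ^ i) x ∈ A → (f ^ i) x = x := by
    simp only [encard_le_one_iff]
    constructor
    · intro h x hx i hi
      exact h x _ _ ⟨⟨i, rfl⟩, hi⟩ ⟨⟨0, by simp⟩, hx⟩
    · rintro h x _ _ ⟨⟨i, rfl⟩, hi⟩ ⟨⟨j, rfl⟩, hj⟩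
      have := h _ hj (i - j) (by rw [← zpow_add_apply]; simpa using hi)
      rw [← zpow_add_apply] at this
      simpa using this
  rw [IsBasicSet, IsQuasiSection, key, and_assoc]
  refine and_congr_right fun hA => and_congr_left fun _ => ⟨fun h x => ?_, fun h U hU hAU => ?_⟩
  · by_contra hne
    rw [not_nonempty_iff_eq_empty, ← disjoint_iff_inter_eq_empty] at hne
    obtain ⟨U, hU, hAU, hUx⟩ := exists_clopen_of_closed_subset_open hA
      (isClosed_omegaLimitPoint f x).isOpen_compl hne.subset_compl_left
    obtain ⟨z, hz, hzU⟩ := (h U hU hAU).2 x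
    exact hUx hzU hz
  · exact ⟨hU, fun x => (h x).mono (inter_subset_inter_right _ hAU)⟩

/-- All points of `U ∩ C`, and those points of `U \ C` whose orbit stays off `U ∩ C` for
`n` steps in both directions. -/
def thin (f : X ≃ₜ X) (C : Set X) (n : ℕ) (U : Set X) : Set X :=
  (U ∩ C) ∪ ((U \ C) \ ⋃ i ∈ Finset.Icc (-n : ℤ) n, (f ^ i) ⁻¹' (U ∩ C))

theorem thin_subset (f : X ≃ₜ X) (C : Set X) (n : ℕ) (U : Set X) : thin f C n U ⊆ U :=
  union_subset inter_subset_left (sdiff_subset.trans sdiff_subset)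

theorem isClopen_thin {f : X ≃ₜ X} {C : Set X} (hC : IsClopen C) (n : ℕ) {U : Set X}
    (hU : IsClopen U) : IsClopen (thin f C n U) :=
  (hU.inter hC).union ((hU.diff hC).diff
    (isClopen_biUnion_finset fun i _ => (hU.inter hC).preimage (f ^ i).continuous))

theorem MeetsOrbits.thin {f : X ≃ₜ X} {U : Set X} (h : MeetsOrbits f U) (C : Set X) (n : ℕ) :
    MeetsOrbits f (thin f C n U) := by
  intro x
  obtain ⟨i, hi⟩ := h x
  by_cases hx : (f ^ i) x ∈ _root_.thin f C n U
  · exact ⟨i, hx⟩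
  · have hxC : (f ^ i) x ∉ C := fun hc => hx (Or.inl ⟨hi, hc⟩)
    by_contra! hcon
    refine hx (Or.inr ⟨⟨hi, hxC⟩, fun hm => ?_⟩)
    simp only [mem_iUnion, mem_preimage, exists_prop] at hm
    obtain ⟨j, -, hj⟩ := hm
    exact hcon (j + i) (Or.inl (by rwa [zpow_add_apply]))

/-- If exactly one of the two points lay in `C`, the other would have been deleted for being within
`n` steps of it. -/
theorem mem_iff_of_mem_thin {f : X ≃ₜ X} {C : Set X} {n : ℕ} {U : Set X} {x : X} {i : ℤ}
    (hi : |i| ≤ n) (hx : x ∈ thin f C n U) (hix : (f ^ i) x ∈ thin f C n U) :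
    x ∈ C ↔ (f ^ i) x ∈ C := by
  rw [abs_le] at hi
  constructor <;> intro h <;> by_contra h'
  · rcases hix with hix | hix
    · exact h' hix.2
    · refine hix.2 ?_
      simp only [mem_iUnion, Finset.mem_Icc, exists_prop, mem_preimage]
      refine ⟨-i, by omega, ?_⟩
      rw [zpow_neg_apply_self]
      exact ⟨thin_subset _ _ _ _ hx, h⟩
  · rcases hx with hx | hx
    · exact h' hx.2
    · refine hx.2 ?_
      simp only [mem_iUnion, Finset.mem_Icc, exists_prop, mem_preimage]
      exact ⟨i, by omega, thin_subset _ _ _ _ hix, h⟩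

/-- Repeated thinning of the whole space along all pairs of a clopen set and a range. -/
def thinSeq (f : X ≃ₜ X) (C : ℕ → Set X) : ℕ → Set X
  | 0 => univ
  | k + 1 => thin f (C k.unpair.1) k.unpair.2 (thinSeq f C k)

/-- Thinning never loses an orbit, so by compactness the intersection of all stages meets every
`ω`-limit set. Every pair of a clopen set and a range is treated at some stage, so two points of one
orbit in the intersection lie in the same sets `C n`. -/
theorem exists_isBasicSet [CompactSpace X] [T2Space X] [TotallyDisconnectedSpace X] (f : X ≃ₜ X)
    {C : ℕ → Set X} (hC : ∀ n, IsClopen (C n)) (hsep : ∀ x y, (∀ n, x ∈ C n ↔ y ∈ C n) → x = y) :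
    ∃ A, IsBasicSet f A := by
  have hcl : ∀ k, IsClopen (thinSeq f C k) := fun k => by
    induction k with
    | zero => exact isClopen_univ
    | succ k ih => exact isClopen_thin (hC _) _ ih
  have hm : ∀ k, MeetsOrbits f (thinSeq f C k) := fun k => by
    induction k with
    | zero => exact fun x => ⟨0, mem_univ _⟩
    | succ k ih => exact ih.thin _ _
  refine ⟨⋂ k, thinSeq f C k, (isBasicSet_iff _ _).2
    ⟨isClosed_iInter fun k => (hcl k).isClosed, fun x => ?_, fun x hx i hix => ?_⟩⟩
  · rw [inter_iInter]
    refine IsCompact.nonempty_iInter_of_sequence_nonempty_isCompact_isClosed _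
      (fun k => inter_subset_inter_right _ (thin_subset _ _ _ _))
      (fun k => (hm k).omegaLimitPoint_inter (hcl k) x)
      ((isClosed_omegaLimitPoint f x).inter (hcl 0).isClosed).isCompact
      fun k => (isClosed_omegaLimitPoint f x).inter (hcl k).isClosed
  · rw [mem_iInter] at hx hix
    refine (hsep _ _ fun n => ?_).symm
    -- The stage just after thinning along `C n` with range `|i|`.
    have h1 := hx (Nat.pair n i.natAbs + 1)
    have h2 := hix (Nat.pair n i.natAbs + 1)
    simp only [thinSeq, Nat.unpair_pair] at h1 h2
    exact mem_iff_of_mem_thin (Int.abs_eq_natAbs i).le h1 h2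

theorem IsBasicSet.exists_isMinimalBasicSet [CompactSpace X] [T2Space X]
    [TotallyDisconnectedSpace X] {f : X ≃ₜ X} {A : Set X} (hA : IsBasicSet f A) :
    ∃ B, IsMinimalBasicSet f B := by
  obtain ⟨B, -, hB⟩ := zorn_superset_nonempty {A | IsBasicSet f A} (fun c hc hch hne => by
    refine ⟨⋂₀ c, ?_, fun s hs => sInter_subset_of_mem hs⟩
    have hc' := fun s (hs : s ∈ c) => (isBasicSet_iff f s).1 (hc hs)
    obtain ⟨s₀, hs₀⟩ := hne
    refine (isBasicSet_iff f _).2 ⟨isClosed_sInter fun s hs => (hc' s hs).1, fun x => ?_,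
      fun x hx i hix => (hc' s₀ hs₀).2.2 x (hx s₀ hs₀) i (hix s₀ hs₀)⟩
    have : Nonempty c := ⟨⟨s₀, hs₀⟩⟩
    rw [sInter_eq_iInter, inter_iInter]
    refine IsCompact.nonempty_iInter_of_directed_nonempty_isCompact_isClosed _ ?_
      (fun s => (hc' s s.2).2.1 x)
      (fun s => ((isClosed_omegaLimitPoint f x).inter (hc' s s.2).1).isCompact)
      (fun s => (isClosed_omegaLimitPoint f x).inter (hc' s s.2).1)
    intro s t
    rcases hch.total s.2 t.2 with h | h
    · exact ⟨s, Subset.rfl, inter_subset_inter_right _ h⟩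
    · exact ⟨t, inter_subset_inter_right _ h, Subset.rfl⟩) A hA
  exact ⟨B, hB⟩

/-- Every nonempty open part of a minimal basic set contains a periodic point. -/
theorem IsMinimalBasicSet.exists_periodic [CompactSpace X] [T2Space X]
    [TotallyDisconnectedSpace X] {f : X ≃ₜ X} {B U : Set X} (hB : IsMinimalBasicSet f B)
    (hU : IsOpen U) (hUB : U ⊆ B) (hne : U.Nonempty) :
    ∃ x ∈ U, ∃ n : ℕ, 0 < n ∧ (f ^ (n : ℤ)) x = x := by
  by_contra! hcon
  have hb := (isBasicSet_iff f B).1 hB.prop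
  -- An `ω`-limit point in `U` forces two visits of the orbit to `U`; as `B` meets an orbit at most
  -- once they coincide, making the visited point periodic. Without periodic points in `U`, the set
  -- `U` could be removed from `B`.
  have h : IsBasicSet f (B \ U) := by
    refine (isBasicSet_iff f _).2 ⟨hb.1.inter hU.isClosed_compl, fun x => ?_,
      fun x hx i hix => hb.2.2 x hx.1 i hix.1⟩
    obtain ⟨z, hz, hzB⟩ := hb.2.1 x
    refine ⟨z, hz, hzB, fun hzU => ?_⟩
    have hz' := (mem_omegaLimitPoint_iff f x z).1 hz U (hU.mem_nhds hzU)
    obtain ⟨k, -, hk⟩ := hz' 0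
    obtain ⟨l, hl, hl'⟩ := hz' (k + 1)
    rw [iterate_eq_zpow] at hk hl'
    have e : ((l - k : ℕ) : ℤ) + k = l := by omega
    refine hcon _ hk (l - k) (by omega) (hb.2.2 _ (hUB hk) _ ?_)
    rw [← zpow_add_apply, e]
    exact hUB hl'
  obtain ⟨x, hx⟩ := hne
  exact (hB.le_of_le h sdiff_subset (hUB hx)).2 hx

end BasicSets

/-! ### Homeomorphisms supported in an open set -/

section Cantor

variable {K : Type*}

/-- The chain of cells around `x` obtained by repeatedly splitting the current cell `A` into
`half n A` and its complement in `A`. -/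
def splitCell (half : ℕ → Set K → Set K) (x : K) : ℕ → Set K
  | 0 => univ
  | n + 1 => {y ∈ splitCell half x n | y ∈ half n (splitCell half x n) ↔
      x ∈ half n (splitCell half x n)}

theorem mem_splitCell_self (half : ℕ → Set K → Set K) (x : K) (n : ℕ) :
    x ∈ splitCell half x n := by
  induction n with
  | zero => exact mem_univ _
  | succ n ih => exact ⟨ih, Iff.rfl⟩

theorem splitCell_antitone (half : ℕ → Set K → Set K) (x : K) : Antitone (splitCell half x) :=
  antitone_nat_of_succ_le fun _ => sep_subset _ _

theorem splitCell_eq_of_mem {half : ℕ → Set K → Set K} {x y : K} {n : ℕ}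
    (h : y ∈ splitCell half x n) : splitCell half y n = splitCell half x n := by
  induction n with
  | zero => rfl
  | succ n ih =>
    have e := ih h.1
    ext z
    simp only [splitCell, e, mem_ofPred_eq]
    exact and_congr_right fun _ => by rw [h.2]

open Classical in
/-- The itinerary of a point in the splitting scheme. -/
noncomputable def splitCode (half : ℕ → Set K → Set K) (x : K) (n : ℕ) : Bool :=
  decide (x ∈ half n (splitCell half x n))

theorem splitCode_eq_of_mem {half : ℕ → Set K → Set K} {x y : K} {n : ℕ}
    (h : y ∈ splitCell half x (n + 1)) : splitCode half y n = splitCode half x n := by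
  simp only [splitCode, splitCell_eq_of_mem h.1, decide_eq_decide]
  exact h.2

theorem splitCell_eq_of_splitCode_eq {half : ℕ → Set K → Set K} {x y : K}
    (h : splitCode half x = splitCode half y) (n : ℕ) :
    splitCell half x n = splitCell half y n := by
  induction n with
  | zero => rfl
  | succ n ih =>
    have := congrFun h n
    simp only [splitCode, decide_eq_decide] at this
    simp only [splitCell, this]
    rw [ih]

variable [TopologicalSpace K]

/-- A nonempty perfect compact zero-dimensional space, with countably many clopen sets separating
its points, is a Cantor set. -/
theorem nonempty_homeomorph_cantor [CompactSpace K] [T2Space K] [TotallyDisconnectedSpace K]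
    [Nonempty K] {C : ℕ → Set K} (hC : ∀ n, IsClopen (C n))
    (hsep : ∀ x y, (∀ n, x ∈ C n ↔ y ∈ C n) → x = y) (hperf : ∀ x : K, ¬ IsOpen {x}) :
    Nonempty (K ≃ₜ (ℕ → Bool)) := by
  -- Cut a cell by `C n` when that is a proper cut, which will give injectivity of the code;
  -- otherwise cut it arbitrarily, which perfectness allows, so that every code is realized.
  have hsplit : ∀ (n : ℕ) (A : Set K), ∃ A', IsClopen A → A.Nonempty → IsClopen A' ∧
      (A ∩ A').Nonempty ∧ (A \ A').Nonempty ∧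
      ((A ∩ C n).Nonempty → (A \ C n).Nonempty → A' = C n) := by
    intro n A
    by_cases h : (A ∩ C n).Nonempty ∧ (A \ C n).Nonempty
    · exact ⟨C n, fun _ _ => ⟨hC n, h.1, h.2, fun _ _ => rfl⟩⟩
    · by_cases hA : IsClopen A ∧ A.Nonempty
      · obtain ⟨x, hx⟩ := hA.2
        obtain ⟨y, hy, hyx⟩ : ∃ y ∈ A, y ≠ x := by
          by_contra! hcon
          refine hperf x ?_
          have : A = {x} := Subset.antisymm hcon (singleton_subset_iff.2 hx)
          exact this ▸ hA.1.isOpen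
        obtain ⟨U, hU, hxU, hyU⟩ := exists_isClopen_of_totally_separated hyx.symm
        exact ⟨U, fun _ _ => ⟨hU, ⟨x, hx, hxU⟩, ⟨y, hy, hyU⟩, fun h1 h2 => (h ⟨h1, h2⟩).elim⟩⟩
      · exact ⟨A, fun h1 h2 => (hA ⟨h1, h2⟩).elim⟩
  choose half hhalf using hsplit
  have hcl : ∀ x n, IsClopen (splitCell half x n) := fun x n => by
    induction n with
    | zero => exact isClopen_univ
    | succ n ih =>
      have h := (hhalf n _ ih ⟨x, mem_splitCell_self _ _ _⟩).1
      by_cases hx : x ∈ half n (splitCell half x n)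
      · simpa [splitCell, hx] using ih.inter h
      · simpa [splitCell, hx, ← mem_compl_iff] using ih.inter h.compl
  have hh := fun x n => hhalf n _ (hcl x n) ⟨x, mem_splitCell_self _ _ _⟩
  have hcont : Continuous (splitCode half) := by
    refine continuous_pi fun n => continuous_iff_continuousAt.2 fun x => ?_
    refine (continuousAt_const (y := splitCode half x n)).congr ?_
    filter_upwards [(hcl x (n + 1)).isOpen.mem_nhds (mem_splitCell_self _ _ _)] with y hy
    exact (splitCode_eq_of_mem hy).symm
  have hinj : Function.Injective (splitCode half) := by
    intro x y hxy
    refine hsep x y fun n => ?_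
    have hy : y ∈ splitCell half x (n + 1) := by
      rw [splitCell_eq_of_splitCode_eq hxy]; exact mem_splitCell_self _ _ _
    have key := (hh x n).2.2.2
    have hx := mem_splitCell_self half x n
    constructor <;> intro hin <;> by_contra hout
    · rw [splitCell, mem_ofPred, key ⟨x, hx, hin⟩ ⟨y, hy.1, hout⟩] at hy
      exact hout (hy.2.2 hin)
    · rw [splitCell, mem_ofPred, key ⟨y, hy.1, hin⟩ ⟨x, hx, hout⟩] at hy
      exact hout (hy.2.1 hin)
  have hsurj : Function.Surjective (splitCode half) := by
    intro s
    have hfin : ∀ n, {x | ∀ k < n, splitCode half x k = s k}.Nonempty := fun n => by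
      induction n with
      | zero =>
        obtain ⟨x⟩ := ‹Nonempty K›
        exact ⟨x, fun k hk => absurd hk (Nat.not_lt_zero k)⟩
      | succ n ih =>
        obtain ⟨x, hx⟩ := ih
        obtain ⟨y, hy, hyn⟩ : ∃ y ∈ splitCell half x n, splitCode half y n = s n := by
          rcases hs : s n
          · obtain ⟨y, hy, hy'⟩ := (hh x n).2.2.1
            exact ⟨y, hy, by simp [splitCode, splitCell_eq_of_mem hy, hy']⟩
          · obtain ⟨y, hy, hy'⟩ := (hh x n).2.1
            exact ⟨y, hy, by simp [splitCode, splitCell_eq_of_mem hy, hy']⟩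
        refine ⟨y, fun k hk => ?_⟩
        rcases Nat.lt_succ_iff_lt_or_eq.1 hk with hk | rfl
        · rw [← hx k hk]
          exact splitCode_eq_of_mem (splitCell_antitone half x hk hy)
        · exact hyn
    have hclosed : ∀ n, IsClosed {x | ∀ k < n, splitCode half x k = s k} := fun n => by
      simp only [ofPred_forall]
      exact isClosed_iInter fun k => isClosed_iInter fun _ =>
        isClosed_eq ((continuous_apply k).comp hcont) continuous_const
    obtain ⟨x, hx⟩ := IsCompact.nonempty_iInter_of_sequence_nonempty_isCompact_isClosed
      (fun n => {x | ∀ k < n, splitCode half x k = s k})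
      (fun n x hx k hk => hx k (lt_trans hk n.lt_succ_self)) hfin (hclosed 0).isCompact hclosed
    exact ⟨x, funext fun n => mem_iInter.1 hx (n + 1) n n.lt_succ_self⟩
  exact ⟨Continuous.homeoOfEquivCompactToT2 (f := Equiv.ofBijective _ ⟨hinj, hsurj⟩) hcont⟩

theorem continuous_swap_of_isOpen_singleton [T1Space K] [DecidableEq K] {p q : K}
    (hp : IsOpen {p}) (hq : IsOpen {q}) : Continuous (Equiv.swap p q) := by
  refine continuous_iff_continuousAt.2 fun x => ?_
  by_cases hxp : x = p
  · subst hxp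
    rw [ContinuousAt, (isOpen_singleton_iff_nhds_eq_pure x).1 hp]
    exact tendsto_pure_left.2 fun s hs => mem_of_mem_nhds hs
  by_cases hxq : x = q
  · subst hxq
    rw [ContinuousAt, (isOpen_singleton_iff_nhds_eq_pure x).1 hq]
    exact tendsto_pure_left.2 fun s hs => mem_of_mem_nhds hs
  refine continuousAt_id.congr ?_
  filter_upwards [isOpen_ne.mem_nhds hxp, isOpen_ne.mem_nhds hxq] with y h1 h2
  exact (Equiv.swap_apply_of_ne_of_ne h1 h2).symm

/-- An open set with at least two points supports a nontrivial homeomorphism. -/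
theorem exists_homeomorph_supported [CompactSpace K] [T2Space K] [TotallyDisconnectedSpace K]
    {C : ℕ → Set K} (hC : ∀ n, IsClopen (C n)) (hsep : ∀ x y, (∀ n, x ∈ C n ↔ y ∈ C n) → x = y)
    {O : Set K} (hO : IsOpen O) (hne : O.Nontrivial) :
    ∃ h : K ≃ₜ K, (∃ x, h x ≠ x) ∧ ∀ x ∉ O, h x = x := by
  classical
  -- Two isolated points of `O` can be swapped. Otherwise `O` contains a Cantor set that is clopen
  -- in `K`, on which flipping all bits has no fixed point.
  by_cases hiso : ∃ p ∈ O, ∃ q ∈ O, p ≠ q ∧ IsOpen {p} ∧ IsOpen {q}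
  · obtain ⟨p, hp, q, hq, hpq, hpo, hqo⟩ := hiso
    refine ⟨Continuous.homeoOfEquivCompactToT2 (f := Equiv.swap p q)
      (continuous_swap_of_isOpen_singleton hpo hqo), ⟨p, ?_⟩, fun x hx => ?_⟩
    · change Equiv.swap p q p ≠ p
      rw [Equiv.swap_apply_left]; exact hpq.symm
    · exact Equiv.swap_apply_of_ne_of_ne (fun h => hx (h ▸ hp)) (fun h => hx (h ▸ hq))
  push Not at hiso
  obtain ⟨O', hO', hO'O, ⟨a, ha⟩, hperf⟩ : ∃ O', IsOpen O' ∧ O' ⊆ O ∧ O'.Nonempty ∧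
      ∀ x ∈ O', ¬ IsOpen {x} := by
    obtain ⟨a, ha, b, hb, hab⟩ := hne
    obtain ⟨P, hP, haP, hbP⟩ := exists_isClopen_of_totally_separated hab
    -- At most one of `O ∩ P` and `O \ P` contains an isolated point; take the other one.
    by_cases h : ∃ x ∈ O ∩ P, IsOpen {x}
    · obtain ⟨x, hx, hxo⟩ := h
      refine ⟨O \ P, hO.sdiff hP.isClosed, sdiff_subset, ⟨b, hb, hbP⟩, fun y hy => ?_⟩
      exact hiso x hx.1 y hy.1 (fun e => hy.2 (e ▸ hx.2)) hxo
    · push Not at h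
      exact ⟨O ∩ P, hO.inter hP.isOpen, inter_subset_left, ⟨a, ha, haP⟩, h⟩
  obtain ⟨L, hL, haL, hLO⟩ := exists_clopen_of_closed_subset_open (isClosed_singleton (x := a))
    hO' (singleton_subset_iff.2 ha)
  have : CompactSpace L := isCompact_iff_compactSpace.1 hL.isClosed.isCompact
  have : Nonempty L := ⟨⟨a, haL rfl⟩⟩
  obtain ⟨e⟩ := nonempty_homeomorph_cantor (K := L) (C := fun n => Subtype.val ⁻¹' C n)
    (fun n => (hC n).preimage continuous_subtype_val)
    (fun x y h => Subtype.ext (hsep _ _ h)) (fun x hx => hperf x (hLO x.2) (by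
      have := hL.isOpen.isOpenMap_subtype_val _ hx
      rwa [image_singleton] at this))
  let flip : (ℕ → Bool) → (ℕ → Bool) := fun s n => !(s n)
  have hflip : Continuous flip :=
    continuous_pi fun n => (continuous_of_discreteTopology (f := not)).comp (continuous_apply n)
  let g : L → L := fun x => e.symm (flip (e x))
  have hg : Continuous g := e.symm.continuous.comp (hflip.comp e.continuous)
  have hgg : ∀ x, g (g x) = x := fun x => by simp [g, flip]
  have hgx : ∀ x, g x ≠ x := fun x hx => by
    have := congrFun (congrArg e hx) 0
    simp [g, flip] at this
  let k : K → K := fun x => if hx : x ∈ L then g ⟨x, hx⟩ else x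
  have hk1 : ∀ x (hx : x ∈ L), k x = g ⟨x, hx⟩ := fun x hx => dif_pos hx
  have hk2 : ∀ x, x ∉ L → k x = x := fun x hx => dif_neg hx
  have hkk : Function.Involutive k := fun x => by
    by_cases hx : x ∈ L
    · rw [hk1 x hx, hk1 _ (g ⟨x, hx⟩).2]
      exact congrArg Subtype.val (hgg ⟨x, hx⟩)
    · rw [hk2 x hx, hk2 x hx]
  have hkc : Continuous k := by
    have h1 : ContinuousOn k L := by
      rw [continuousOn_iff_continuous_domRestrict]
      exact (continuous_subtype_val.comp hg).congr fun x => (hk1 x x.2).symm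
    have h2 : ContinuousOn k Lᶜ := continuousOn_id.congr hk2
    rw [← continuousOn_univ, ← union_compl_self L]
    exact h1.union_of_isOpen h2 hL.isOpen hL.compl.isOpen
  refine ⟨Continuous.homeoOfEquivCompactToT2 (f := hkk.toPerm) hkc, ⟨a, ?_⟩, fun x hx => ?_⟩
  · change k a ≠ a
    rw [hk1 a (haL rfl)]
    exact fun h => hgx _ (Subtype.ext h)
  · exact hk2 x fun h => hx (hO'O (hLO h))

end Cantor

/-! ### Lexicographic order and maximal paths -/

namespace OrderedBratteliDiagram

variable {D : OrderedBratteliDiagram}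

theorem not_lexLT_self (p : D.PathSpace) : ¬ D.LexLT p p := fun ⟨_, h, _⟩ => lt_irrefl _ h

theorem LexLT.trans {p q r : D.PathSpace} (hpq : D.LexLT p q) (hqr : D.LexLT q r) :
    D.LexLT p r := by
  obtain ⟨k, hk, hk'⟩ := hpq
  obtain ⟨l, hl, hl'⟩ := hqr
  rcases lt_trichotomy k l with h | rfl | h
  · exact ⟨l, hk' l h ▸ hl, fun m hm => (hk' m (h.trans hm)).trans (hl' m hm)⟩
  · exact ⟨k, hk.trans hl, fun m hm => (hk' m hm).trans (hl' m hm)⟩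
  · exact ⟨k, hl' k h ▸ hk, fun m hm => (hk' m hm).trans (hl' m (h.trans hm))⟩

theorem isClosed_maxPaths (D : OrderedBratteliDiagram) : IsClosed D.maxPaths := by
  simp only [maxPaths, ofPred_forall]
  exact isClosed_iInter fun n => (isClosed_discrete {e : D.E n | IsMax e}).preimage
    ((continuous_apply n).comp continuous_subtype_val)

theorem nonempty_pathSpace (D : BratteliDiagram) : Nonempty D.PathSpace := by
  have e₀ : D.E 0 := (D.nonempty_E 0).some
  exact ⟨⟨fun n => Nat.rec e₀ (fun n e => (D.s_surjective (n + 1) (D.r e)).choose) n,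
    fun n => (D.s_surjective (n + 1) _).choose_spec.symm⟩⟩

/-- Periodic orbits of a Vershik homeomorphism pass through a maximal path. -/
theorem ExtendsVershikMap.exists_mem_maxPaths {ψ : D.PathSpace ≃ₜ D.PathSpace}
    (hψ : D.ExtendsVershikMap ψ) {p : D.PathSpace} {n : ℕ} (hn : 0 < n) (hp : ψ^[n] p = p) :
    ∃ i : ℕ, ψ^[i] p ∈ D.maxPaths := by
  by_contra! hcon
  have key : ∀ k, D.LexLT p (ψ^[k + 1] p) := fun k => by
    induction k with
    | zero => exact (hψ _ (hcon 0)).1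
    | succ k ih =>
      refine ih.trans ?_
      rw [Function.iterate_succ_apply' ψ (k + 1)]
      exact (hψ _ (hcon (k + 1))).1
  obtain ⟨k, rfl⟩ := Nat.exists_eq_succ_of_ne_zero hn.ne'
  have := key k
  rw [← Nat.succ_eq_add_one, hp] at this
  exact not_lexLT_self p this

end OrderedBratteliDiagram

/-- Homeomorphisms that agree off a set with at most one interior point are equal. -/
theorem Homeomorph.eq_of_interior_subsingleton {X : Type*} [TopologicalSpace X]
    {Y : Type*} [TopologicalSpace Y] [T2Space Y]
    {M : Set X} (hM : (interior M).Subsingleton) {g h : X ≃ₜ Y} (hgh : ∀ x ∉ M, g x = h x) :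
    g = h := by
  have key : ∀ x ∉ interior M, g x = h x := fun x hx => by
    have hx' : x ∈ closure Mᶜ := by rwa [closure_compl]
    exact closure_minimal (t := {x | g x = h x}) hgh (isClosed_eq g.continuous h.continuous) hx'
  ext x
  by_cases hx : x ∈ interior M
  · obtain ⟨y, hy⟩ := h.surjective (g x)
    by_cases hyM : y ∈ interior M
    · rw [← hy, hM hyM hx]
    · have := g.injective ((key y hyM).trans hy)
      exact (hyM (this ▸ hx)).elim
  · exact key x hx

/-! ### Decisiveness and interior points -/

section Decisive

variable {X : Type*} [TopologicalSpace X] [CompactSpace X] [T2Space X] [TotallyDisconnectedSpace X]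

/-- The Vershik map says nothing about maximal paths, so precomposing `ψ` with a homeomorphism
supported in their interior gives another extension. -/
theorem OrderedBratteliDiagram.IsDecisive.subsingleton_interior
    {C : ℕ → Set X} (hC : ∀ n, IsClopen (C n)) (hsep : ∀ x y, (∀ n, x ∈ C n ↔ y ∈ C n) → x = y)
    {D : OrderedBratteliDiagram} (hD : D.IsDecisive) (φ : X ≃ₜ D.PathSpace) :
    (interior (φ ⁻¹' D.maxPaths)).Subsingleton := by
  rw [← not_nontrivial_iff]
  intro hne
  obtain ⟨h, ⟨x, hx⟩, hfix⟩ := exists_homeomorph_supported hC hsep isOpen_interior hne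
  obtain ⟨ψ, hψ, huniq⟩ := hD
  have : (φ.symm.trans (h.trans φ)).trans ψ = ψ := huniq _ fun p hp => by
    have := hfix (φ.symm p) fun hin => hp (by simpa using interior_subset hin)
    simpa [this] using hψ p hp
  have := DFunLike.congr_fun this (φ x)
  simp only [Homeomorph.trans_apply, Homeomorph.symm_apply_apply] at this
  exact hx (φ.injective (ψ.injective this))

theorem IsMinimalBasicSet.subsingleton_interior {f : X ≃ₜ X} {B M : Set X}
    (hB : IsMinimalBasicSet f B) (hM : IsClosed M) (hint : (interior M).Subsingleton)
    (hper : ∀ x, ∀ n : ℕ, 0 < n → (f ^ (n : ℤ)) x = x → ∃ i : ℤ, (f ^ i) x ∈ M) :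
    (interior B).Subsingleton := by
  have hb := (isBasicSet_iff f B).1 hB.prop
  have key : ∀ U, IsOpen U → U ⊆ B → U.Nonempty → ∃ y ∈ U, ∃ i : ℤ, (f ^ i) y ∈ interior M := by
    intro U hU hUB hne
    obtain ⟨p, hp, n, hn, hpn⟩ := hB.exists_periodic hU hUB hne
    -- All points of `U'` are periodic of period `n`: both `y` and its `n`-th iterate lie in `B`.
    -- Hence the preimages of `M` under powers of `f` cover `U'`, and Baire's theorem applies.
    let U' := U ∩ (f ^ (n : ℤ)) ⁻¹' U
    have hU' : IsOpen U' := hU.inter (hU.preimage (f ^ (n : ℤ)).continuous)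
    have hd := dense_iUnion_interior_of_closed (f := fun i : ℤ => U'ᶜ ∪ (f ^ i) ⁻¹' M)
      (fun i => hU'.isClosed_compl.union (hM.preimage (f ^ i).continuous)) (by
        refine eq_univ_of_forall fun y => ?_
        by_cases hy : y ∈ U'
        · obtain ⟨i, hi⟩ := hper y n hn (hb.2.2 y (hUB hy.1) n (hUB hy.2))
          exact mem_iUnion.2 ⟨i, Or.inr hi⟩
        · exact mem_iUnion.2 ⟨0, Or.inl hy⟩)
    obtain ⟨y, hy, hyi⟩ := hd.inter_open_nonempty U' hU'
      ⟨p, hp, by rw [mem_preimage, hpn]; exact hp⟩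
    obtain ⟨i, hi⟩ := mem_iUnion.1 hyi
    refine ⟨y, hy.1, i, ?_⟩
    have hW : U' ∩ interior (U'ᶜ ∪ (f ^ i) ⁻¹' M) ⊆ interior ((f ^ i) ⁻¹' M) :=
      interior_maximal (fun z hz => (interior_subset hz.2).resolve_left fun h => h hz.1)
        (hU'.inter isOpen_interior)
    have := hW ⟨hy, hi⟩
    rwa [← Homeomorph.preimage_interior] at this
  intro a ha b hb'
  by_contra hab
  obtain ⟨Ua, Ub, hUa, hUb, haU, hbU, hdis⟩ := t2_separation hab
  obtain ⟨y, hy, i, hyi⟩ := key (interior B ∩ Ua) (isOpen_interior.inter hUa)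
    (inter_subset_left.trans interior_subset) ⟨a, ha, haU⟩
  obtain ⟨z, hz, j, hzj⟩ := key (interior B ∩ Ub) (isOpen_interior.inter hUb)
    (inter_subset_left.trans interior_subset) ⟨b, hb', hbU⟩
  have e := hint hyi hzj
  have e' : (f ^ (i - j)) y = z := by
    rw [sub_eq_neg_add, zpow_add_apply, e, zpow_neg_apply_self]
  have := hb.2.2 y (interior_subset hy.1) (i - j) (e' ▸ interior_subset hz.1)
  exact hdis.le_bot ⟨hy.2, (this.symm.trans e') ▸ hz.2⟩

theorem exists_clopen_enumeration [SecondCountableTopology X] :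
    ∃ C : ℕ → Set X, (∀ n, IsClopen (C n)) ∧ ∀ U, IsClopen U → ∃ n, C n = U := by
  have := TopologicalSpace.Clopens.countable_iff_secondCountable.2 ‹SecondCountableTopology X›
  obtain ⟨C, hC⟩ := exists_surjective_nat (TopologicalSpace.Clopens X)
  exact ⟨fun n => C n, fun n => (C n).isClopen, fun U hU => by
    obtain ⟨n, hn⟩ := hC ⟨U, hU⟩
    exact ⟨n, congrArg SetLike.coe hn⟩⟩

/-- A closed set is the intersection of a decreasing sequence of clopen sets starting with the
whole space. -/
theorem IsClosed.exists_antitone_clopen [SecondCountableTopology X] {B : Set X}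
    (hB : IsClosed B) : ∃ U : ℕ → Set X, U 0 = univ ∧ (∀ n, IsClopen (U n)) ∧ Antitone U ∧
      ⋂ n, U n = B := by
  classical
  obtain ⟨C, hC, hCs⟩ := exists_clopen_enumeration (X := X)
  let W : ℕ → Set X := fun n => if B ⊆ C n then C n else univ
  have hW : ∀ n, IsClopen (W n) := fun n => by
    by_cases h : B ⊆ C n
    · simpa [W, h] using hC n
    · simp [W, h, isClopen_univ]
  have hBW : ∀ n, B ⊆ W n := fun n => by
    by_cases h : B ⊆ C n
    · simp [W, h]
    · simp [W, h]
  refine ⟨fun n => ⋂ k ∈ Finset.range n, W k, by simp, fun n => isClopen_biInter_finset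
    fun k _ => hW k, fun m n hmn => biInter_subset_biInter_left fun k hk => ?_, ?_⟩
  · simp only [Finset.coe_range, mem_Iio] at hk ⊢
    exact lt_of_lt_of_le hk hmn
  · refine Subset.antisymm (fun x hx => ?_) (subset_iInter fun n => subset_iInter₂ fun k _ => hBW k)
    by_contra hxB
    obtain ⟨U, hU, hBU, hUx⟩ := exists_clopen_of_closed_subset_open hB
      (isClosed_singleton (x := x)).isOpen_compl (subset_compl_singleton_iff.2 hxB)
    obtain ⟨n, rfl⟩ := hCs U hU
    have := mem_iInter₂.1 (mem_iInter.1 hx (n + 1)) n (Finset.mem_range.2 n.lt_succ_self)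
    simp only [W, hBU, if_true] at this
    exact hUx this rfl

end Decisive

/-! ### Kakutani–Rokhlin partitions and their ordered diagram -/

section Towers

variable {X : Type*} [TopologicalSpace X]

/-- A refining sequence of Kakutani-Rokhlin partitions of a system: at level `n` the point `x` lies
in the tower named `vert n x` at height `pos n x`. -/
structure TowerSystem (f : X ≃ₜ X) where
  Code : ℕ → Type
  vert : ∀ n, X → Code n
  pos : ℕ → X → ℕ
  vert_zero : ∀ x y, vert 0 x = vert 0 y
  pos_zero : ∀ x, pos 0 x = 0
  isLocallyConstant : ∀ n, IsLocallyConstant fun x => (vert n x, pos n x)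
  refines : ∀ {n x y}, vert (n + 1) x = vert (n + 1) y → pos (n + 1) x = pos (n + 1) y →
    vert n x = vert n y ∧ pos n x = pos n y
  separates : ∀ {x y}, (∀ n, vert n x = vert n y ∧ pos n x = pos n y) → x = y
  step : ∀ n x, (pos n (f x) = pos n x + 1 ∧ vert n (f x) = vert n x) ∨
    (pos n (f x) = 0 ∧ ∀ y, vert n y = vert n x → pos n y ≤ pos n x)
  pos_eq_zero_of_succ : ∀ {n x}, pos (n + 1) x = 0 → pos n x = 0

namespace TowerSystem

variable {f : X ≃ₜ X} (T : TowerSystem f)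

/-- The height at which the visited tower of level `n` sits inside the tower of level `n + 1`. -/
def off (n : ℕ) (x : X) : ℕ := T.pos (n + 1) x - T.pos n x

variable {T}

theorem step_of_pos_ne_zero {n : ℕ} {x : X} (h : T.pos n (f x) ≠ 0) :
    T.pos n (f x) = T.pos n x + 1 ∧ T.vert n (f x) = T.vert n x :=
  (T.step n x).resolve_right fun h' => h h'.1

theorem step_symm_of_pos_ne_zero {n : ℕ} {x : X} (h : T.pos n x ≠ 0) :
    T.pos n x = T.pos n (f.symm x) + 1 ∧ T.vert n (f.symm x) = T.vert n x := by
  have := step_of_pos_ne_zero (T := T) (n := n) (x := f.symm x) (by simpa using h)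
  simpa [eq_comm] using this

theorem pos_succ_ne_zero {n : ℕ} {x : X} (h : T.pos n x ≠ 0) : T.pos (n + 1) x ≠ 0 :=
  fun h' => h (T.pos_eq_zero_of_succ h')

theorem pos_ne_zero_of_le {m n : ℕ} {x : X} (hmn : m ≤ n) (h : T.pos m x ≠ 0) :
    T.pos n x ≠ 0 := by
  induction n, hmn using Nat.le_induction with
  | base => exact h
  | succ n _ ih => exact pos_succ_ne_zero ih

/-- Bases are nested, so the last visit to the level `n` base is no earlier than the last visit to
the level `n + 1` base. -/
theorem pos_le_pos_succ (n : ℕ) (x : X) : T.pos n x ≤ T.pos (n + 1) x := by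
  induction hk : T.pos (n + 1) x generalizing x with
  | zero => exact (T.pos_eq_zero_of_succ hk).le
  | succ k ih =>
    have h1 := step_symm_of_pos_ne_zero (T := T) (n := n + 1) (x := x) (by omega)
    have h2 := ih (f.symm x) (by omega)
    by_cases h : T.pos n x = 0
    · omega
    · have := step_symm_of_pos_ne_zero h
      omega

theorem pos_add_off (n : ℕ) (x : X) : T.pos n x + T.off n x = T.pos (n + 1) x := by
  have := T.pos_le_pos_succ n x
  unfold off; omega

/-- A point off the base at level `n` is off it at level `n + 1`, so both positions drop together
and the offset is kept. -/
theorem exists_down {n : ℕ} {z : X} {k : ℕ} (hk : k ≤ T.pos n z) :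
    ∃ x, T.vert n x = T.vert n z ∧ T.pos n x = k ∧
      T.vert (n + 1) x = T.vert (n + 1) z ∧ T.off n x = T.off n z := by
  induction hd : T.pos n z - k generalizing z with
  | zero => exact ⟨z, rfl, by omega, rfl, rfl⟩
  | succ d ih =>
    have h1 := step_symm_of_pos_ne_zero (T := T) (n := n) (x := z) (by omega)
    have h2 := step_symm_of_pos_ne_zero (T := T) (n := n + 1) (x := z)
      (pos_succ_ne_zero (by omega))
    obtain ⟨x, hx1, hx2, hx3, hx4⟩ := ih (z := f.symm z) (by omega) (by omega)
    refine ⟨x, hx1.trans h1.2, hx2, hx3.trans h2.2, hx4.trans ?_⟩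
    unfold off; omega

theorem exists_up {n : ℕ} {y z : X} (h : T.vert n y = T.vert n z) (hle : T.pos n z ≤ T.pos n y) :
    ∃ x, T.vert n x = T.vert n z ∧ T.pos n x = T.pos n y ∧
      T.vert (n + 1) x = T.vert (n + 1) z ∧ T.off n x = T.off n z := by
  induction hd : T.pos n y - T.pos n z generalizing z with
  | zero => exact ⟨z, rfl, by omega, rfl, rfl⟩
  | succ d ih =>
    have h1 := (T.step n z).resolve_right fun h' => by have := h'.2 y h; omega
    have h2 := step_of_pos_ne_zero (T := T) (n := n + 1) (x := z) (pos_succ_ne_zero (by omega))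
    obtain ⟨x, hx1, hx2, hx3, hx4⟩ := ih (z := f z) (h.trans h1.2.symm) (by omega) (by omega)
    refine ⟨x, hx1.trans h1.2, hx2, hx3.trans h2.2, hx4.trans ?_⟩
    unfold off; omega

/-- Moving inside a tower of level `n` without leaving the tower of level `n + 1`. -/
theorem exists_move {n : ℕ} {y z : X} (h : T.vert n y = T.vert n z) :
    ∃ x, T.vert n x = T.vert n y ∧ T.pos n x = T.pos n y ∧
      T.vert (n + 1) x = T.vert (n + 1) z ∧ T.off n x = T.off n z := by
  rw [h]
  rcases le_total (T.pos n z) (T.pos n y) with hle | hle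
  · exact exists_up h hle
  · exact exists_down hle

/-- Descend to the floors where the two level `n` visits begin: these have the same position in the
same level `n + 1` tower, so `refines` applies. Thus an edge is determined by its range and offset,
and edges with a common range are totally ordered by offset. -/
theorem vert_eq_of_off_eq {n : ℕ} {x y : X} (hv : T.vert (n + 1) x = T.vert (n + 1) y)
    (ho : T.off n x = T.off n y) : T.vert n x = T.vert n y := by
  obtain ⟨x', h1, h2, h3, h4⟩ := exists_down (T := T) (n := n) (z := x) (Nat.zero_le _)
  obtain ⟨y', k1, k2, k3, k4⟩ := exists_down (T := T) (n := n) (z := y) (Nat.zero_le _)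
  have := T.pos_add_off n x'
  have := T.pos_add_off n y'
  rw [← h1, ← k1]
  exact (T.refines (by rw [h3, k3, hv]) (by omega)).1

/-- Climbing one floor keeps the offset inside a level `n` tower and raises it when a new one is
entered. -/
theorem off_mono {n : ℕ} {x y : X} (hv : T.vert (n + 1) x = T.vert (n + 1) y)
    (hp : T.pos (n + 1) x ≤ T.pos (n + 1) y) : T.off n x ≤ T.off n y := by
  induction hd : T.pos (n + 1) y - T.pos (n + 1) x generalizing y with
  | zero =>
    have := (T.refines hv (by omega)).2
    unfold off; omega
  | succ d ih =>
    have h1 := step_symm_of_pos_ne_zero (T := T) (n := n + 1) (x := y) (by omega)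
    have h2 := ih (y := f.symm y) (hv.trans h1.2.symm) (by omega) (by omega)
    have := T.pos_add_off n y
    have := T.pos_add_off n (f.symm y)
    by_cases h : T.pos n y = 0
    · omega
    · have := step_symm_of_pos_ne_zero h
      omega

theorem pos_lt_of_off_lt {n : ℕ} {x y : X} (hv : T.vert (n + 1) x = T.vert (n + 1) y)
    (ho : T.off n x < T.off n y) : T.pos (n + 1) x < T.pos (n + 1) y := by
  by_contra h
  exact absurd (off_mono hv.symm (not_lt.1 h)) (by omega)

theorem exists_off_eq_zero (n : ℕ) (x : X) :
    ∃ y, T.vert (n + 1) y = T.vert (n + 1) x ∧ T.off n y = 0 := by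
  obtain ⟨y, hy, hy0, -⟩ := exists_down (T := T) (n := n + 1) (z := x) (Nat.zero_le _)
  have := T.pos_add_off n y
  exact ⟨y, hy, by omega⟩

theorem refines_of_le {m n : ℕ} {x y : X} (hmn : m ≤ n) (hv : T.vert n x = T.vert n y)
    (hp : T.pos n x = T.pos n y) : T.vert m x = T.vert m y ∧ T.pos m x = T.pos m y := by
  induction n, hmn using Nat.le_induction with
  | base => exact ⟨hv, hp⟩
  | succ n _ ih =>
    have := T.refines hv hp
    exact ih this.1 this.2

theorem isLocallyConstant_vert (n : ℕ) : IsLocallyConstant (T.vert n) :=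
  (T.isLocallyConstant n).comp Prod.fst

theorem isLocallyConstant_pos (n : ℕ) : IsLocallyConstant (T.pos n) :=
  (T.isLocallyConstant n).comp Prod.snd

variable (T)

theorem exists_pos_iterate_eq_zero [CompactSpace X] (n : ℕ) (x : X) : ∃ h, 0 < h ∧ T.pos n (f^[h] x) = 0 := by
  by_contra! hcon
  have key : ∀ k, T.pos n (f^[k] x) = T.pos n x + k := fun k => by
    induction k with
    | zero => rfl
    | succ k ih =>
      have := hcon (k + 1) k.succ_pos
      rw [Function.iterate_succ_apply'] at this ⊢
      rw [(step_of_pos_ne_zero this).1, ih, add_assoc]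
  obtain ⟨N, hN⟩ := (isLocallyConstant_pos (T := T) n).range_finite.bddAbove
  have := hN ⟨f^[N + 1] x, rfl⟩
  rw [key] at this
  omega

theorem isLocallyConstant_edge (n : ℕ) :
    IsLocallyConstant fun x => (T.vert n x, T.vert (n + 1) x, T.off n x) :=
  (isLocallyConstant_vert n).prodMk ((isLocallyConstant_vert (n + 1)).prodMk
    (((isLocallyConstant_pos (n + 1)).prodMk (isLocallyConstant_pos n)).comp fun p => p.1 - p.2))

/-- The ordered Bratteli diagram of a sequence of Kakutani-Rokhlin partitions. -/
def diagram [CompactSpace X] [Nonempty X] : OrderedBratteliDiagram where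
  V n := range (T.vert n)
  E n := range fun x => (T.vert n x, T.vert (n + 1) x, T.off n x)
  s e := ⟨e.1.1, e.2.imp fun _ h => congrArg Prod.fst h⟩
  r e := ⟨e.1.2.1, e.2.imp fun _ h => congrArg (fun q => q.2.1) h⟩
  finite_V n := (isLocallyConstant_vert n).range_finite
  nonempty_V n := (range_nonempty _).to_subtype
  finite_E n := (T.isLocallyConstant_edge n).range_finite
  nonempty_E n := (range_nonempty _).to_subtype
  subsingleton_V_zero := ⟨by
    rintro ⟨_, x, rfl⟩ ⟨_, y, rfl⟩
    exact Subtype.ext (T.vert_zero x y)⟩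
  s_surjective n := by
    rintro ⟨_, x, rfl⟩
    exact ⟨⟨_, x, rfl⟩, rfl⟩
  r_surjective n := by
    rintro ⟨_, x, rfl⟩
    exact ⟨⟨_, x, rfl⟩, rfl⟩
  order n :=
    { le := fun e e' => e = e' ∨ (e.1.2.1 = e'.1.2.1 ∧ e.1.2.2 < e'.1.2.2)
      le_refl := fun e => Or.inl rfl
      le_trans := by
        rintro e e' e'' (rfl | h) (rfl | h')
        · exact Or.inl rfl
        · exact Or.inr h'
        · exact Or.inr h
        · exact Or.inr ⟨h.1.trans h'.1, h.2.trans h'.2⟩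
      le_antisymm := by
        rintro e e' (rfl | h) (h' | h')
        · rfl
        · rfl
        · exact h'.symm
        · exact absurd (h.2.trans h'.2) (lt_irrefl _) }
  comparable_iff := by
    rintro n ⟨_, x, rfl⟩ ⟨_, y, rfl⟩
    constructor
    · rintro ((h | h) | (h | h))
      · exact Subtype.ext (congrArg (fun e => e.1.2.1) h)
      · exact Subtype.ext h.1
      · exact Subtype.ext (congrArg (fun e => e.1.2.1) h.symm)
      · exact Subtype.ext h.1.symm
    · intro h
      have h := congrArg Subtype.val h
      rcases lt_trichotomy (T.off n x) (T.off n y) with ho | ho | ho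
      · exact Or.inl (Or.inr ⟨h, ho⟩)
      · exact Or.inl (Or.inl (Subtype.ext (Prod.ext (vert_eq_of_off_eq h ho) (Prod.ext h ho))))
      · exact Or.inr (Or.inr ⟨h.symm, ho⟩)

end TowerSystem

end Towers

/-! ### Conjugacy with the Vershik map on the path space -/

namespace TowerSystem

variable {X : Type*} [TopologicalSpace X] {f : X ≃ₜ X} (T : TowerSystem f)
variable [CompactSpace X] [Nonempty X]

/-- The vertex of a point at level `n`. -/
def vtx (n : ℕ) (x : X) : T.diagram.V n := ⟨T.vert n x, x, rfl⟩

/-- The edge of a point between levels `n` and `n + 1`. -/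
def edge (n : ℕ) (x : X) : T.diagram.E n := ⟨(T.vert n x, T.vert (n + 1) x, T.off n x), x, rfl⟩

theorem s_edge (n : ℕ) (x : X) : T.diagram.s (T.edge n x) = T.vtx n x := rfl

theorem r_edge (n : ℕ) (x : X) : T.diagram.r (T.edge n x) = T.vtx (n + 1) x := rfl

variable {T}

theorem exists_edge_eq {n : ℕ} (e : T.diagram.E n) : ∃ x, T.edge n x = e := by
  obtain ⟨_, x, rfl⟩ := e
  exact ⟨x, rfl⟩

theorem exists_vtx_eq {n : ℕ} (v : T.diagram.V n) : ∃ x, T.vtx n x = v := by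
  obtain ⟨_, x, rfl⟩ := v
  exact ⟨x, rfl⟩

theorem vtx_eq_iff {n : ℕ} {x y : X} : T.vtx n x = T.vtx n y ↔ T.vert n x = T.vert n y :=
  Subtype.ext_iff

theorem edge_eq_iff {n : ℕ} {x y : X} : T.edge n x = T.edge n y ↔
    T.vert n x = T.vert n y ∧ T.vert (n + 1) x = T.vert (n + 1) y ∧ T.off n x = T.off n y := by
  refine Subtype.ext_iff.trans ?_
  simp only [edge, Prod.mk.injEq]

theorem edge_eq_of_off_eq {n : ℕ} {x y : X} (hv : T.vert (n + 1) x = T.vert (n + 1) y)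
    (ho : T.off n x = T.off n y) : T.edge n x = T.edge n y :=
  edge_eq_iff.2 ⟨vert_eq_of_off_eq hv ho, hv, ho⟩

theorem edge_lt_iff {n : ℕ} {x y : X} : T.edge n x < T.edge n y ↔
    T.vert (n + 1) x = T.vert (n + 1) y ∧ T.off n x < T.off n y := by
  have hle : T.edge n x ≤ T.edge n y ↔ T.edge n x = T.edge n y ∨
    (T.vert (n + 1) x = T.vert (n + 1) y ∧ T.off n x < T.off n y) := Iff.rfl
  rw [lt_iff_le_and_ne, hle]
  constructor
  · rintro ⟨h | h, hne⟩
    · exact absurd h hne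
    · exact h
  · intro h
    exact ⟨Or.inr h, fun he => h.2.ne (edge_eq_iff.1 he).2.2⟩

theorem isMin_edge_iff {n : ℕ} {x : X} : IsMin (T.edge n x) ↔ T.off n x = 0 := by
  constructor
  · intro h
    obtain ⟨y, hy, hy0⟩ := exists_off_eq_zero n x
    by_contra h0
    exact h.not_lt (edge_lt_iff.2 ⟨hy, by omega⟩)
  · intro h e he
    obtain ⟨y, rfl⟩ := exists_edge_eq e
    rcases he.lt_or_eq with he | he
    · have := (edge_lt_iff.1 he).2
      omega
    · exact he.ge

theorem not_isMax_edge_iff {n : ℕ} {x : X} : ¬ IsMax (T.edge n x) ↔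
    ∃ y, T.vert (n + 1) x = T.vert (n + 1) y ∧ T.off n x < T.off n y := by
  rw [not_isMax_iff]
  constructor
  · rintro ⟨e, he⟩
    obtain ⟨y, rfl⟩ := exists_edge_eq e
    exact ⟨y, edge_lt_iff.1 he⟩
  · rintro ⟨y, hy⟩
    exact ⟨_, edge_lt_iff.2 hy⟩

variable (T)

/-- The infinite path of a point. -/
def path (x : X) : T.diagram.PathSpace := ⟨fun n => T.edge n x, fun _ => rfl⟩

theorem path_apply (x : X) (n : ℕ) : (T.path x).1 n = T.edge n x := rfl

variable {T}

theorem vert_eq_of_edge_eq {n : ℕ} {x y : X} (h : T.edge n x = T.edge n y) :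
    T.vert n x = T.vert n y := (edge_eq_iff.1 h).1

theorem edge_eq_of_lt {m n : ℕ} {x y : X} (hmn : m < n) (hv : T.vert n x = T.vert n y)
    (hp : T.pos n x = T.pos n y) : T.edge m x = T.edge m y := by
  have h1 := refines_of_le hmn hv hp
  have h2 := refines_of_le hmn.le hv hp
  exact edge_eq_iff.2 ⟨h2.1, h1.1, by rw [off, off, h1.2, h2.2]⟩

theorem pos_eq_of_edge_eq {n : ℕ} {x y : X} (h : ∀ m < n, T.edge m x = T.edge m y) :
    T.pos n x = T.pos n y := by
  induction n with
  | zero => rw [T.pos_zero, T.pos_zero]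
  | succ n ih =>
    have h1 := ih fun m hm => h m (hm.trans n.lt_succ_self)
    have h2 := (edge_eq_iff.1 (h n n.lt_succ_self)).2.2
    rw [← pos_add_off, ← pos_add_off, h1, h2]

theorem path_injective : Function.Injective T.path := by
  intro x y h
  have h' : ∀ n, T.edge n x = T.edge n y := fun n => congrFun (congrArg Subtype.val h) n
  exact T.separates fun n => ⟨vert_eq_of_edge_eq (h' n), pos_eq_of_edge_eq fun m _ => h' m⟩

theorem isLocallyConstant_edgeMap (n : ℕ) : IsLocallyConstant (T.edge n) := by
  refine (IsLocallyConstant.iff_eventually_eq _).2 fun x => ?_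
  filter_upwards [(IsLocallyConstant.iff_eventually_eq _).1 (T.isLocallyConstant_edge n) x] with y hy
  exact Subtype.ext hy

theorem continuous_path : Continuous T.path :=
  Continuous.subtype_mk (continuous_pi fun n => (isLocallyConstant_edgeMap n).continuous) _

/-- A point realizing the next edge is moved within its level `n` tower to the floor of a point
realizing the prefix. This changes neither the next edge nor the prefix prescribed by that floor. -/
theorem exists_forall_lt_edge_eq (p : T.diagram.PathSpace) (n : ℕ) :
    ∃ x, (∀ m < n, T.edge m x = p.1 m) ∧ T.vtx n x = T.diagram.s (p.1 n) := by
  induction n with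
  | zero =>
    obtain ⟨x, hx⟩ := exists_edge_eq (p.1 0)
    exact ⟨x, fun m hm => absurd hm (Nat.not_lt_zero m), congrArg T.diagram.s hx⟩
  | succ n ih =>
    obtain ⟨y, hy, hyn⟩ := ih
    obtain ⟨z, hz⟩ := exists_edge_eq (p.1 n)
    rw [← hz, s_edge, vtx_eq_iff] at hyn
    obtain ⟨x, h1, h2, h3, h4⟩ := exists_move hyn
    have hxz : T.edge n x = T.edge n z := edge_eq_of_off_eq h3 h4
    refine ⟨x, fun m hm => ?_, ?_⟩
    · rcases Nat.lt_succ_iff_lt_or_eq.1 hm with hm | rfl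
      · rw [← hy m hm]
        exact edge_eq_of_lt hm h1 h2
      · rw [hxz, hz]
    · rw [← p.2 n, ← hz, ← hxz, r_edge]

theorem path_surjective : Function.Surjective T.path := by
  intro p
  have hclosed : ∀ n, IsClosed {x | ∀ m < n, T.edge m x = p.1 m} := fun n => by
    simp only [ofPred_forall]
    exact isClosed_iInter fun m => isClosed_iInter fun _ =>
      isClosed_eq (isLocallyConstant_edgeMap m).continuous continuous_const
  obtain ⟨x, hx⟩ := IsCompact.nonempty_iInter_of_sequence_nonempty_isCompact_isClosed
    (fun n => {x | ∀ m < n, T.edge m x = p.1 m})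
    (fun n x hx m hm => hx m (lt_trans hm n.lt_succ_self))
    (fun n => (exists_forall_lt_edge_eq p n).imp fun _ h => h.1) (hclosed 0).isCompact hclosed
  exact ⟨x, Subtype.ext (funext fun n => mem_iInter.1 hx (n + 1) n n.lt_succ_self)⟩

variable (T)

/-- The path map as a homeomorphism. -/
noncomputable def pathHomeo : X ≃ₜ T.diagram.PathSpace :=
  Continuous.homeoOfEquivCompactToT2
    (f := Equiv.ofBijective T.path ⟨path_injective, path_surjective⟩) continuous_path

theorem pathHomeo_apply (x : X) : T.pathHomeo x = T.path x := rfl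

/-- The system transported to the path space. -/
noncomputable def vershik : T.diagram.PathSpace ≃ₜ T.diagram.PathSpace :=
  T.pathHomeo.symm.trans (f.trans T.pathHomeo)

theorem vershik_path (x : X) : T.vershik (T.path x) = T.path (f x) := by
  simp [vershik, ← pathHomeo_apply]

variable {T}

theorem pos_lt_pos_iff_of_edge_eq {m n : ℕ} {x y : X} (hmn : m ≤ n)
    (h : ∀ l, m ≤ l → T.edge l x = T.edge l y) :
    T.pos n x < T.pos n y ↔ T.pos m x < T.pos m y := by
  induction n, hmn using Nat.le_induction with
  | base => rfl
  | succ n hn ih =>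
    have h1 := T.pos_add_off n x
    have h2 := T.pos_add_off n y
    have h3 := (edge_eq_iff.1 (h n hn)).2.2
    rw [← ih]
    omega

/-- The lexicographic order on cofinal paths compares heights in a common tower. -/
theorem lexLT_path_iff {n : ℕ} {x y : X} (h : ∀ l, n ≤ l → T.edge l x = T.edge l y) :
    T.diagram.LexLT (T.path x) (T.path y) ↔ T.pos n x < T.pos n y := by
  constructor
  · rintro ⟨k, hk, hk'⟩
    simp only [path_apply, edge_lt_iff] at hk
    have hk1 : ∀ l, k + 1 ≤ l → T.edge l x = T.edge l y := fun l hl => hk' l hl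
    have hkn : k < n := by
      by_contra hcon
      have := (edge_eq_iff.1 (h k (not_lt.1 hcon))).2.2
      omega
    rw [pos_lt_pos_iff_of_edge_eq hkn hk1]
    exact pos_lt_of_off_lt hk.1 hk.2
  · intro hp
    induction n with
    | zero => simp [T.pos_zero] at hp
    | succ n ih =>
      have hv := vert_eq_of_edge_eq (h (n + 1) le_rfl)
      rcases lt_trichotomy (T.off n x) (T.off n y) with ho | ho | ho
      · exact ⟨n, edge_lt_iff.2 ⟨hv, ho⟩, fun l hl => h l hl⟩
      · have he := edge_eq_of_off_eq hv ho
        have h1 := T.pos_add_off n x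
        have h2 := T.pos_add_off n y
        refine ih (fun l hl => ?_) (by omega)
        rcases hl.eq_or_lt with rfl | hl
        · exact he
        · exact h l hl
      · exact absurd (pos_lt_of_off_lt hv.symm ho) hp.asymm

/-- From level `n` on, `f` climbs one floor in every tower, so offsets do not change. -/
theorem edge_map_eq {n m : ℕ} {x : X} (hnm : n ≤ m) (h : T.pos n (f x) ≠ 0) :
    T.edge m x = T.edge m (f x) := by
  have h1 := step_of_pos_ne_zero (pos_ne_zero_of_le hnm h)
  have h2 := step_of_pos_ne_zero (pos_ne_zero_of_le (show n ≤ m + 1 by omega) h)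
  refine edge_eq_iff.2 ⟨h1.2.symm, h2.2.symm, ?_⟩
  unfold off; omega

variable (T)

theorem extendsVershikMap : T.diagram.ExtendsVershikMap T.vershik := by
  intro p hp
  obtain ⟨x, rfl⟩ := path_surjective p
  rw [vershik_path]
  obtain ⟨n, hn⟩ : ∃ n, ¬ IsMax (T.edge n x) := by
    by_contra! hcon
    exact hp hcon
  obtain ⟨z, hz, hoz⟩ := not_isMax_edge_iff.1 hn
  have hpz := pos_lt_of_off_lt hz hoz
  -- A non-maximal edge means that `x` is not on the top floor at level `n + 1`; so `f x` lies one
  -- floor higher, and nothing fits between them in any larger common tower.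
  have hs := (T.step (n + 1) x).resolve_right fun h => by
    have := h.2 z hz.symm
    omega
  have hne : T.pos (n + 1) (f x) ≠ 0 := by omega
  refine ⟨(lexLT_path_iff fun l hl => edge_map_eq hl hne).2 (by omega), fun q hq => ?_⟩
  obtain ⟨y, rfl⟩ := path_surjective q
  obtain ⟨k, -, hk⟩ := id hq
  let N := max k n + 1
  have hxy : ∀ l, N ≤ l → T.edge l x = T.edge l y := fun l hl => hk l (by omega)
  have hxf : ∀ l, N ≤ l → T.edge l x = T.edge l (f x) := fun l hl =>
    edge_map_eq (show n + 1 ≤ l by omega) hne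
  have hfy : ∀ l, N ≤ l → T.edge l (f x) = T.edge l y := fun l hl =>
    (hxf l hl).symm.trans (hxy l hl)
  have hlt := (lexLT_path_iff hxy).1 hq
  have hstep := step_of_pos_ne_zero (pos_ne_zero_of_le (show n + 1 ≤ N by omega) hne)
  rcases (show T.pos N (f x) ≤ T.pos N y by omega).eq_or_lt with he | hl
  · left
    refine Subtype.ext (funext fun m => ?_)
    rcases lt_or_ge m N with hm | hm
    · exact edge_eq_of_lt hm (vert_eq_of_edge_eq (hfy N le_rfl)) he
    · exact hfy m hm
  · exact Or.inr ((lexLT_path_iff hfy).2 hl)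

theorem path_mem_minPaths_iff {x : X} : T.path x ∈ T.diagram.minPaths ↔ ∀ n, T.pos n x = 0 := by
  have : T.path x ∈ T.diagram.minPaths ↔ ∀ n, T.off n x = 0 :=
    forall_congr' fun n => isMin_edge_iff
  rw [this]
  constructor
  · intro h n
    induction n with
    | zero => exact T.pos_zero x
    | succ n ih => rw [← pos_add_off, ih, h n]
  · intro h n
    rw [off, h, h]

theorem mapsTo_vershik : MapsTo T.vershik T.diagram.maxPaths T.diagram.minPaths := by
  intro p hp
  obtain ⟨x, rfl⟩ := path_surjective p
  rw [vershik_path, path_mem_minPaths_iff]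
  intro n
  by_contra h
  have := step_of_pos_ne_zero h
  obtain ⟨k, hk, -⟩ := (lexLT_path_iff fun l hl => edge_map_eq hl h).2
    (show T.pos n x < T.pos n (f x) by omega)
  exact (hp k).not_lt hk

theorem isBratteliVershikModel : T.diagram.IsBratteliVershikModel T.vershik :=
  ⟨T.extendsVershikMap, T.mapsTo_vershik⟩

theorem isDecisive [T2Space X] (h : (interior {x | ∀ n, T.pos n x = 0}).Subsingleton) :
    T.diagram.IsDecisive := by
  refine ⟨T.vershik, T.extendsVershikMap, fun ψ hψ => ?_⟩
  have e : T.diagram.maxPaths ⊆ (T.pathHomeo.symm.trans f.symm.symm) ⁻¹'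
      {x | ∀ n, T.pos n x = 0} := by
    intro p hp
    have := T.mapsTo_vershik hp
    obtain ⟨x, rfl⟩ := path_surjective p
    rw [vershik_path, path_mem_minPaths_iff] at this
    simpa [← pathHomeo_apply] using this
  -- Off the maximal paths an extension is forced, because least successors are unique.
  have hint : (interior T.diagram.maxPaths).Subsingleton := by
    refine Subsingleton.anti ?_ (interior_mono e)
    rw [← Homeomorph.preimage_interior]
    exact h.preimage (Homeomorph.injective _)
  refine Homeomorph.eq_of_interior_subsingleton hint fun p hp => ?_
  rcases (hψ p hp).2 _ (T.extendsVershikMap p hp).1 with h1 | h1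
  · exact h1
  · rcases (T.extendsVershikMap p hp).2 _ (hψ p hp).1 with h2 | h2
    · exact h2.symm
    · exact (OrderedBratteliDiagram.not_lexLT_self _ (h1.trans h2)).elim

end TowerSystem

theorem zpow_apply_eq_self {X : Type*} [TopologicalSpace X] {g : X ≃ₜ X} {x : X} (h : g x = x)
    (i : ℤ) : (g ^ i) x = x := by
  have hn : ∀ n : ℕ, (g ^ (n : ℤ)) x = x := fun n => by
    rw [← iterate_eq_zpow]; exact Function.iterate_fixed h n
  obtain ⟨n, rfl | rfl⟩ := i.eq_nat_or_neg
  · exact hn n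
  · conv_lhs => rw [← hn n]
    exact zpow_neg_apply_self g n x

/-! ### Tower heights and the closing property -/

namespace TowerSystem

variable {X : Type*} [TopologicalSpace X] {f : X ≃ₜ X} (T : TowerSystem f)
variable [CompactSpace X] [Nonempty X]

/-- The heights of the floors of the tower over a vertex. -/
def floors {n : ℕ} (v : T.diagram.V n) : Set ℕ := {j | ∃ x, T.vtx n x = v ∧ T.pos n x = j}

/-- The offsets along a finite path add up to a floor of its final tower, and each floor arises
exactly once; hence the path count equals the tower height. -/
theorem nonempty_finPath_equiv (n : ℕ) (v : T.diagram.V n) :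
    Nonempty (T.diagram.FinPath n v ≃ T.floors v) := by
  induction n with
  | zero =>
    obtain ⟨x, rfl⟩ := exists_vtx_eq v
    have : T.floors (T.vtx 0 x) = {0} := by
      ext j
      constructor
      · rintro ⟨y, -, rfl⟩; exact T.pos_zero y
      · rintro rfl; exact ⟨x, rfl, T.pos_zero x⟩
    rw [this]
    exact ⟨(Equiv.ofUnique Unit ({0} : Set ℕ))⟩
  | succ n ih =>
    let g : (Σ e : {e : T.diagram.E n // T.diagram.r e = v}, T.floors (T.diagram.s e.1)) → ℕ :=
      fun q => q.2.1 + q.1.1.1.2.2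
    have hg : ∀ q, ∃ x, T.vtx (n + 1) x = v ∧ T.edge n x = q.1.1 ∧ T.pos n x = q.2.1 ∧
        T.pos (n + 1) x = g q := by
      rintro ⟨⟨e, rfl⟩, j, y, hy, rfl⟩
      obtain ⟨z, rfl⟩ := exists_edge_eq e
      obtain ⟨x, -, h2, h3, h4⟩ := exists_move (vtx_eq_iff.1 hy)
      refine ⟨x, vtx_eq_iff.2 h3, edge_eq_of_off_eq h3 h4, h2, ?_⟩
      rw [← pos_add_off, h2, h4]
      rfl
    have hinj : Function.Injective g := by
      intro q q' hqq
      obtain ⟨x, h1, h2, h3, h4⟩ := hg q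
      obtain ⟨x', h1', h2', h3', h4'⟩ := hg q'
      have hv := vtx_eq_iff.1 (h1.trans h1'.symm)
      have hp : T.pos (n + 1) x = T.pos (n + 1) x' := by rw [h4, h4', hqq]
      have he := edge_eq_of_lt n.lt_succ_self hv hp
      have hj := (T.refines hv hp).2
      rw [h2, h2'] at he
      rw [h3, h3'] at hj
      obtain ⟨⟨e, he1⟩, ⟨j, hj1⟩⟩ := q
      obtain ⟨⟨e', he1'⟩, ⟨j', hj1'⟩⟩ := q'
      dsimp only at he hj
      subst he hj
      rfl
    have hrange : range g = T.floors v := by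
      ext k
      constructor
      · rintro ⟨q, rfl⟩
        obtain ⟨x, h1, -, -, h4⟩ := hg q
        exact ⟨x, h1, h4⟩
      · rintro ⟨x, rfl, rfl⟩
        exact ⟨⟨⟨T.edge n x, rfl⟩, T.pos n x, x, rfl, rfl⟩, T.pos_add_off n x⟩
    exact ⟨(Equiv.sigmaCongrRight fun e : {e : T.diagram.E n // T.diagram.r e = v} => (ih (T.diagram.s e.1)).some).trans
      ((Equiv.ofInjective g hinj).trans (Equiv.setCongr hrange))⟩

theorem height_eq {n : ℕ} (v : T.diagram.V n) : T.diagram.height v = (T.floors v).ncard :=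
  Nat.card_congr (T.nonempty_finPath_equiv n v).some

theorem vershik_iterate (k : ℕ) (x : X) : T.vershik^[k] (T.path x) = T.path (f^[k] x) := by
  induction k generalizing x with
  | zero => rfl
  | succ k ih => rw [Function.iterate_succ_apply, vershik_path, ih, ← Function.iterate_succ_apply]

/-- The closing property holds as soon as no orbit meets the intersection of the bases twice. -/
theorem hasClosingProperty
    (hB : ∀ x, (∀ n, T.pos n x = 0) → ∀ k : ℕ, (∀ n, T.pos n (f^[k] x) = 0) → f^[k] x = x) :
    T.diagram.HasClosingProperty T.vershik := by
  intro n c hc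
  have huniq : ∀ k (e : T.diagram.E (n + k)), T.diagram.r e = T.diagram.r (c.1 k) → e = c.1 k := by
    intro k e he
    obtain ⟨e', he'⟩ := encard_eq_one.1 (hc k)
    have h1 : e ∈ T.diagram.r ⁻¹' {T.diagram.r (c.1 k)} := he
    have h2 : c.1 k ∈ T.diagram.r ⁻¹' {T.diagram.r (c.1 k)} := rfl
    rw [he', mem_singleton_iff] at h1 h2
    rw [h1, h2]
  -- The only edge into the tower must be the one of offset 0, so the tower consists of a single
  -- copy of the previous one.
  have hdown : ∀ k y, T.vtx (n + k + 1) y = T.diagram.s (c.1 (k + 1)) →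
      T.vtx (n + k) y = T.diagram.s (c.1 k) ∧ T.off (n + k) y = 0 := by
    intro k y hy
    have h1 : T.edge (n + k) y = c.1 k := huniq k _ (hy.trans (c.2 k).symm)
    obtain ⟨z, hz, hz0⟩ := T.exists_off_eq_zero (n + k) y
    have h2 : T.edge (n + k) z = c.1 k :=
      huniq k _ ((vtx_eq_iff.2 hz).trans (hy.trans (c.2 k).symm))
    exact ⟨congrArg T.diagram.s h1, by rw [← hz0, (edge_eq_iff.1 (h1.trans h2.symm)).2.2]⟩
  have hpos : ∀ k y, T.vtx (n + k) y = T.diagram.s (c.1 k) →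
      T.vtx n y = T.diagram.s (c.1 0) ∧ T.pos (n + k) y = T.pos n y := by
    intro k
    induction k with
    | zero => exact fun y hy => ⟨hy, rfl⟩
    | succ k ih =>
      intro y hy
      have h1 := hdown k y hy
      have h2 := ih y h1.1
      have h3 := T.pos_add_off (n + k) y
      exact ⟨h2.1, by rw [← h2.2, ← add_assoc]; omega⟩
  let S : Set X := {y | ∀ k, T.vtx (n + k) y = T.diagram.s (c.1 k)}
  have hSpath : ∀ y, T.path y ∈ ⋂ k, T.diagram.tower (T.diagram.s (c.1 k)) ↔ y ∈ S := fun y => by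
    rw [mem_iInter]; rfl
  have hstep : ∀ y ∈ S, T.pos n (f y) ≠ 0 → f y ∈ S := fun y hy h0 k => by
    rw [← hy k, vtx_eq_iff]
    exact (step_of_pos_ne_zero (pos_ne_zero_of_le (Nat.le_add_right n k) h0)).2
  -- Compactness provides a point in all towers of `c`; walking down brings it to the base.
  obtain ⟨x, hxS, hx0⟩ : ∃ x ∈ S, T.pos n x = 0 := by
    have hclosed : ∀ k, IsClosed {y | T.vtx (n + k) y = T.diagram.s (c.1 k)} := fun k => by
      obtain ⟨z, hz⟩ := exists_vtx_eq (T.diagram.s (c.1 k))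
      simp only [← hz, vtx_eq_iff]
      exact (isLocallyConstant_vert (n + k)).isClosed_fiber _
    obtain ⟨y, hy⟩ := IsCompact.nonempty_iInter_of_sequence_nonempty_isCompact_isClosed
      (fun k => {y | T.vtx (n + k) y = T.diagram.s (c.1 k)}) (fun k y hy => (hdown k y hy).1)
      (fun k => exists_vtx_eq _) (hclosed 0).isCompact hclosed
    have hyS : y ∈ S := fun k => mem_iInter.1 hy k
    clear hy
    induction hp : T.pos n y generalizing y with
    | zero => exact ⟨y, hyS, hp⟩
    | succ p ih =>
      have h1 := step_symm_of_pos_ne_zero (T := T) (n := n) (x := y) (by omega)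
      refine ih (f.symm y) (fun k => ?_) (by omega)
      rw [← hyS k, vtx_eq_iff]
      exact (step_symm_of_pos_ne_zero
        (pos_ne_zero_of_le (Nat.le_add_right n k) (by omega))).2
  classical
  have hex := T.exists_pos_iterate_eq_zero n x
  -- The first return time to the level `n` base. It will be both the height of the tower and the
  -- least period.
  let h := Nat.find hex
  obtain ⟨hh0, hh⟩ : 0 < h ∧ T.pos n (f^[h] x) = 0 := Nat.find_spec hex
  have hmin : ∀ i, 0 < i → i < h → T.pos n (f^[i] x) ≠ 0 := fun i hi hih h0 =>
    Nat.find_min hex hih ⟨hi, h0⟩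
  have horb : ∀ i < h, f^[i] x ∈ S ∧ T.pos n (f^[i] x) = i := by
    intro i
    induction i with
    | zero => exact fun _ => ⟨hxS, hx0⟩
    | succ i ih =>
      intro hi
      obtain ⟨h1, h2⟩ := ih (by omega)
      have h3 := hmin (i + 1) i.succ_pos hi
      rw [Function.iterate_succ_apply'] at h3 ⊢
      exact ⟨hstep _ h1 h3, by rw [(step_of_pos_ne_zero h3).1, h2]⟩
  obtain ⟨hwS, hwp⟩ := horb (h - 1) (by omega)
  have hfw : f^[h] x = f (f^[h - 1] x) := by
    rw [← Function.iterate_succ_apply' f, Nat.succ_eq_add_one, Nat.sub_add_cancel hh0]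
  -- On the towers of `c`, positions agree at all levels from `n` on. So `x` and its first return
  -- lie in the bases of every level, and `hB` identifies them.
  have hper : f^[h] x = x := by
    refine hB x (fun m => ?_) h (fun m => ?_)
    · have h1 := (hpos m x (hxS m)).2
      by_contra hne
      exact pos_ne_zero_of_le (Nat.le_add_left m n) hne (h1.trans hx0)
    · by_contra hne
      have hne' := pos_ne_zero_of_le (Nat.le_add_left m n) hne
      rw [hfw] at hne' hh
      have h1 := step_of_pos_ne_zero hne'
      exact hne' ((hpos m _ ((vtx_eq_iff.2 h1.2).trans (hwS m))).2.trans hh)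
  have hfloor : ∀ y, T.vtx n y = T.diagram.s (c.1 0) → T.pos n y < h := by
    intro y hy
    have h1 := (T.step n (f^[h - 1] x)).resolve_left fun h' => by
      have := h'.1
      rw [← hfw, hh] at this
      omega
    have := h1.2 y (vtx_eq_iff.1 (hy.trans (hwS 0).symm))
    omega
  refine ⟨T.path x, ⟨h, hh0, ?_⟩, ?_, ?_⟩
  · rw [Function.IsPeriodicPt, Function.IsFixedPt, vershik_iterate, hper]
  · have hmem : Function.IsPeriodicPt T.vershik h (T.path x) := by
      rw [Function.IsPeriodicPt, Function.IsFixedPt, vershik_iterate, hper]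
    have hfl : T.floors (T.diagram.s (c.1 0)) = Iio h := by
      ext j
      constructor
      · rintro ⟨y, hy, rfl⟩
        exact hfloor y hy
      · intro hj
        exact ⟨f^[j] x, (horb j hj).1 0, (horb j hj).2⟩
    rw [height_eq, hfl, ← Finset.coe_Iio, ncard_coe_finset, Nat.card_Iio]
    refine le_antisymm (hmem.minimalPeriod_le hh0) (Nat.find_min' hex
      ⟨hmem.minimalPeriod_pos hh0, ?_⟩)
    have := Function.isPeriodicPt_minimalPeriod T.vershik (T.path x)
    rw [Function.IsPeriodicPt, Function.IsFixedPt, vershik_iterate] at this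
    rw [path_injective this, hx0]
  · ext p
    obtain ⟨y, rfl⟩ := path_surjective p
    rw [hSpath]
    constructor
    · intro hy
      have hyh := hfloor y (hy 0)
      obtain ⟨h1, h2⟩ := horb _ hyh
      have hyx : f^[T.pos n y] x = y := by
        refine T.separates fun m => ?_
        refine refines_of_le (Nat.le_add_left m n) (vtx_eq_iff.1 ((h1 m).trans (hy m).symm)) ?_
        rw [(hpos m _ (h1 m)).2, (hpos m _ (hy m)).2, h2]
      refine ⟨T.pos n y, ?_⟩
      change (T.vershik ^ (T.pos n y : ℤ)) (T.path x) = T.path y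
      rw [← iterate_eq_zpow, vershik_iterate, hyx]
    · rintro ⟨i, hi⟩
      have hi : (T.vershik ^ i) (T.path x) = T.path y := hi
      have hfix : (T.vershik ^ (h : ℤ)) (T.path x) = T.path x := by
        rw [← iterate_eq_zpow, vershik_iterate, hper]
      have hmod := Int.emod_nonneg i (show (h : ℤ) ≠ 0 by omega)
      have hlt := Int.emod_lt_of_pos i (show (0 : ℤ) < h by omega)
      rw [← Int.emod_add_mul_ediv i h, zpow_add_apply, zpow_mul, zpow_apply_eq_self hfix,
        ← Int.toNat_of_nonneg hmod, ← iterate_eq_zpow, vershik_iterate] at hi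
      rw [← path_injective hi]
      exact (horb _ (by omega)).1

end TowerSystem

/-! ### Kakutani–Rokhlin partitions from clopen bases -/

section Construction

variable {X : Type*} [TopologicalSpace X]

/-- The time elapsed since the last visit to `U`. -/
noncomputable def lag (f : X ≃ₜ X) (U : Set X) (x : X) : ℕ :=
  sInf {k : ℕ | (f ^ (-k : ℤ)) x ∈ U}

variable {f : X ≃ₜ X} {U : Set X}

theorem lag_le {x : X} {k : ℕ} (h : (f ^ (-k : ℤ)) x ∈ U) : lag f U x ≤ k := Nat.sInf_le h

theorem notMem_of_lt_lag {x : X} {k : ℕ} (h : k < lag f U x) : (f ^ (-k : ℤ)) x ∉ U :=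
  Nat.notMem_of_lt_sInf h

theorem lag_eq_zero_of_mem {x : X} (h : x ∈ U) : lag f U x = 0 :=
  Nat.le_zero.1 (lag_le (by simpa using h))

section Compact

variable [CompactSpace X]

/-- A past visit exists by compactness, so the infimum is attained and is not the default value 0 of
an empty set. -/
theorem zpow_neg_lag_mem (hU : IsOpen U) (hm : MeetsOrbits f U) (x : X) :
    (f ^ (-lag f U x : ℤ)) x ∈ U := by
  have : {k : ℕ | (f ^ (-k : ℤ)) x ∈ U}.Nonempty := by
    obtain ⟨k, hk, hx⟩ := hm.exists_le hU x 0
    refine ⟨k.natAbs, ?_⟩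
    rw [mem_ofPred_eq, show (-(k.natAbs : ℤ)) = k by omega]
    exact hx
  exact Nat.sInf_mem this

theorem lag_eq_zero_iff (hU : IsOpen U) (hm : MeetsOrbits f U) {x : X} :
    lag f U x = 0 ↔ x ∈ U := by
  refine ⟨fun h => ?_, lag_eq_zero_of_mem⟩
  simpa [h] using zpow_neg_lag_mem hU hm x

theorem lag_eq_of (hU : IsOpen U) (hm : MeetsOrbits f U) {x : X} {k : ℕ}
    (h : (f ^ (-k : ℤ)) x ∈ U) (h' : ∀ j : ℕ, j < k → (f ^ (-j : ℤ)) x ∉ U) : lag f U x = k :=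
  le_antisymm (lag_le h) (not_lt.1 fun hlt => h' _ hlt (zpow_neg_lag_mem hU hm x))

theorem lag_map (hU : IsOpen U) (hm : MeetsOrbits f U) {x : X} (h : f x ∉ U) :
    lag f U (f x) = lag f U x + 1 := by
  have e : ∀ k : ℕ, (f ^ (-(k + 1 : ℕ) : ℤ)) (f x) = (f ^ (-k : ℤ)) x := fun k => by
    rw [show f x = (f ^ (1 : ℤ)) x by simp, ← zpow_add_apply]
    congr 2; push_cast; ring
  refine lag_eq_of hU hm ?_ fun j hj => ?_
  · rw [e]; exact zpow_neg_lag_mem hU hm x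
  · cases j with
    | zero => simpa using h
    | succ j => rw [e]; exact notMem_of_lt_lag (by omega)

theorem lag_zpow (hU : IsOpen U) (hm : MeetsOrbits f U) {x : X} {j : ℕ} (h : j ≤ lag f U x) :
    lag f U ((f ^ (j - lag f U x : ℤ)) x) = j := by
  refine lag_eq_of hU hm ?_ fun i hi => ?_ <;> rw [← zpow_add_apply]
  · rw [show (-j + (j - lag f U x) : ℤ) = -lag f U x by ring]
    exact zpow_neg_lag_mem hU hm x
  · rw [show (-i + (j - lag f U x) : ℤ) = -(lag f U x - j + i : ℕ) by omega]
    exact notMem_of_lt_lag (by omega)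

theorem isLocallyConstant_lag (hU : IsClopen U) (hm : MeetsOrbits f U) :
    IsLocallyConstant (lag f U) := by
  refine (IsLocallyConstant.iff_eventually_eq _).2 fun x => ?_
  have h1 : ∀ᶠ y in 𝓝 x, (f ^ (-lag f U x : ℤ)) y ∈ U :=
    (f ^ (-lag f U x : ℤ)).continuous.continuousAt.eventually_mem
      (hU.isOpen.mem_nhds (zpow_neg_lag_mem hU.isOpen hm x))
  have h2 : ∀ᶠ y in 𝓝 x, ∀ j ∈ Finset.range (lag f U x), (f ^ (-j : ℤ)) y ∈ Uᶜ :=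
    (Finset.range _).eventually_all.2 fun j hj =>
      (f ^ (-j : ℤ)).continuous.continuousAt.eventually_mem
        (hU.compl.isOpen.mem_nhds (notMem_of_lt_lag (Finset.mem_range.1 hj)))
  filter_upwards [h1, h2] with y hy1 hy2
  exact lag_eq_of hU.isOpen hm hy1 fun j hj => hy2 j (Finset.mem_range.2 hj)

end Compact

/-- The names of the towers: a tower of level `n + 1` is named by the list of the sets that its
floors visit. -/
def TowerCode : ℕ → Type
  | 0 => Unit
  | n + 1 => ℕ → Set (TowerCode n × ℕ × Prop)

/-- The name of the tower of level `n` over the base `U n` containing a point. -/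
noncomputable def towerCode (f : X ≃ₜ X) (U C : ℕ → Set X) : ∀ n, X → TowerCode n
  | 0, _ => ()
  -- Each entry has at most one element: the first condition holds exactly when the tower has a
  -- floor `j`, so empty entries record its height. Membership in `C n` is stored so that the codes
  -- separate points.
  | n + 1, x => fun j => {s |
      lag f (U (n + 1)) ((f ^ (j - lag f (U (n + 1)) x : ℤ)) x) = j ∧
      s = (towerCode f U C n ((f ^ (j - lag f (U (n + 1)) x : ℤ)) x),
        lag f (U n) ((f ^ (j - lag f (U (n + 1)) x : ℤ)) x),
        (f ^ (j - lag f (U (n + 1)) x : ℤ)) x ∈ C n)}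

variable {U C : ℕ → Set X}

theorem towerCode_refines {n : ℕ} {x y : X}
    (hv : towerCode f U C (n + 1) x = towerCode f U C (n + 1) y)
    (hp : lag f (U (n + 1)) x = lag f (U (n + 1)) y) :
    towerCode f U C n x = towerCode f U C n y ∧ lag f (U n) x = lag f (U n) y ∧
      (x ∈ C n ↔ y ∈ C n) := by
  have h := congrFun hv (lag f (U (n + 1)) x)
  have hx : (towerCode f U C n x, lag f (U n) x, x ∈ C n) ∈
      towerCode f U C (n + 1) x (lag f (U (n + 1)) x) := by
    simp [towerCode]
  rw [h, hp] at hx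
  have := hx.2
  simp only [sub_self, zpow_zero, Homeomorph.one_apply, Prod.mk.injEq] at this
  exact ⟨this.1, this.2.1, iff_of_eq this.2.2⟩

variable [CompactSpace X]

/-- The code depends only on the orbit segment starting at the last visit to the base, and that
visit is unchanged while climbing. -/
theorem towerCode_map {n : ℕ} {x : X} (hU : IsOpen (U n)) (hm : MeetsOrbits f (U n))
    (h : f x ∉ U n) : towerCode f U C n (f x) = towerCode f U C n x := by
  cases n with
  | zero => rfl
  | succ n =>
    have e : ∀ j : ℕ, (f ^ (j - lag f (U (n + 1)) (f x) : ℤ)) (f x) =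
        (f ^ (j - lag f (U (n + 1)) x : ℤ)) x := fun j => by
      rw [lag_map hU hm h]
      conv_lhs => rw [show f x = (f ^ (1 : ℤ)) x by simp, ← zpow_add_apply]
      congr 2; push_cast; ring
    funext j
    simp only [towerCode, e]

/-- Since `f x` is back in the base, the entry just above the floor of `x` is empty; a higher point
with the same code would make it nonempty. -/
theorem lag_le_of_towerCode_eq {n : ℕ} {x y : X} (hU : IsOpen (U (n + 1)))
    (hm : MeetsOrbits f (U (n + 1))) (h : f x ∈ U (n + 1))
    (hv : towerCode f U C (n + 1) y = towerCode f U C (n + 1) x) :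
    lag f (U (n + 1)) y ≤ lag f (U (n + 1)) x := by
  by_contra! hlt
  have h1 := lag_zpow hU hm (Nat.succ_le_of_lt hlt)
  have h2 : (towerCode f U C (n + 1) y (lag f (U (n + 1)) x + 1)).Nonempty := ⟨_, h1, rfl⟩
  rw [hv] at h2
  obtain ⟨-, h3, -⟩ := h2
  rw [show ((lag f (U (n + 1)) x + 1 : ℕ) - lag f (U (n + 1)) x : ℤ) = 1 by omega, zpow_one,
    lag_eq_zero_of_mem h] at h3
  omega

theorem isLocallyConstant_towerCode (hU : ∀ n, IsClopen (U n)) (hm : ∀ n, MeetsOrbits f (U n))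
    (hC : ∀ n, IsClopen (C n)) (n : ℕ) : IsLocallyConstant (towerCode f U C n) := by
  induction n with
  | zero => exact IsLocallyConstant.const ()
  | succ n ih =>
    have hl := fun n => isLocallyConstant_lag (hU n) (hm n)
    have hCn : IsLocallyConstant fun x => x ∈ C n := by
      refine (IsLocallyConstant.iff_eventually_eq _).2 fun x => ?_
      by_cases hx : x ∈ C n
      · filter_upwards [(hC n).isOpen.mem_nhds hx] with y hy
        simp [hx, hy]
      · filter_upwards [(hC n).compl.isOpen.mem_nhds hx] with y hy
        simp only [hx, eq_iff_iff, iff_false]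
        exact hy
    have hall : IsLocallyConstant fun x =>
        (lag f (U (n + 1)) x, towerCode f U C n x, lag f (U n) x, x ∈ C n) :=
      (hl _).prodMk (ih.prodMk ((hl n).prodMk hCn))
    -- No floor lies above `N`, so only finitely many entries need to be controlled near `x`.
    obtain ⟨N, hN⟩ := (hl (n + 1)).range_finite.bddAbove
    refine (IsLocallyConstant.iff_eventually_eq _).2 fun x => ?_
    have h2 : ∀ᶠ y in 𝓝 x, ∀ j ∈ Finset.range (N + 1), _ :=
      (Finset.range (N + 1)).eventually_all.2 fun j _ =>
        (IsLocallyConstant.iff_eventually_eq _).1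
          (hall.comp_continuous (f ^ (j - lag f (U (n + 1)) x : ℤ)).continuous) x
    filter_upwards [(IsLocallyConstant.iff_eventually_eq _).1 (hl (n + 1)) x, h2] with y hy1 hy2
    funext j
    simp only [towerCode, hy1]
    by_cases hj : j ≤ N
    · have := hy2 j (Finset.mem_range.2 (by omega))
      simp only [Function.comp_apply, Prod.mk.injEq] at this
      simp only [this]
    · have h0 : ∀ z, lag f (U (n + 1)) z ≠ j := fun z hz => hj (hz ▸ hN ⟨z, rfl⟩)
      simp only [h0, false_and]

/-- The Kakutani-Rokhlin partitions over a decreasing sequence of clopen bases. -/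
noncomputable def TowerSystem.ofBases (f : X ≃ₜ X) (U C : ℕ → Set X) (hU0 : U 0 = univ)
    (hU : ∀ n, IsClopen (U n)) (hanti : Antitone U) (hm : ∀ n, MeetsOrbits f (U n))
    (hC : ∀ n, IsClopen (C n)) (hsep : ∀ x y, (∀ n, x ∈ C n ↔ y ∈ C n) → x = y) :
    TowerSystem f where
  Code := TowerCode
  vert := towerCode f U C
  pos n := lag f (U n)
  vert_zero _ _ := rfl
  pos_zero x := lag_eq_zero_of_mem (hU0 ▸ mem_univ x)
  isLocallyConstant n :=
    (isLocallyConstant_towerCode hU hm hC n).prodMk (isLocallyConstant_lag (hU n) (hm n))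
  refines hv hp := ⟨(towerCode_refines hv hp).1, (towerCode_refines hv hp).2.1⟩
  separates h := hsep _ _ fun n => (towerCode_refines (h (n + 1)).1 (h (n + 1)).2).2.2
  step n x := by
    by_cases h : f x ∈ U n
    · refine Or.inr ⟨lag_eq_zero_of_mem h, fun y hy => ?_⟩
      cases n with
      | zero => exact (lag_eq_zero_of_mem (hU0 ▸ mem_univ y)).trans_le (Nat.zero_le _)
      | succ n => exact lag_le_of_towerCode_eq (hU _).isOpen (hm _) h hy
    · exact Or.inl ⟨lag_map (hU n).isOpen (hm n) h, towerCode_map (hU n).isOpen (hm n) h⟩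
  pos_eq_zero_of_succ {n x} h :=
    lag_eq_zero_of_mem (hanti n.le_succ ((lag_eq_zero_iff (hU _).isOpen (hm _)).1 h))

end Construction

/-! ### The model over a minimal basic set -/

theorem mainTheorem6 {X : Type*} [TopologicalSpace X] [CompactSpace X]
    [TopologicalSpace.MetrizableSpace X]
    (hX : TopologicalSpace.IsTopologicalBasis {U : Set X | IsClopen U})
    (f : X ≃ₜ X) (hf : IsBratteliVershikizable f) :
    ∃ (D : OrderedBratteliDiagram) (ψ : D.PathSpace ≃ₜ D.PathSpace) (φ : X ≃ₜ D.PathSpace)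
      (B : Set X),
      D.IsDecisive ∧ D.IsBratteliVershikModel ψ ∧ D.HasClosingProperty ψ ∧
        IsTopConjugacy f ψ φ ∧ IsMinimalBasicSet f B ∧ φ '' B = D.minPaths := by
  obtain ⟨D, ψ, φ, hD, hψ, hφ⟩ := hf
  have hts : TotallySeparatedSpace X :=
    (totallySeparatedSpace_iff_exists_isClopen).2 fun x y hxy => by
      obtain ⟨U, hU, hxU, hUy⟩ := hX.exists_subset_of_mem_open
        (show x ∈ ({y} : Set X)ᶜ from hxy) isClosed_singleton.isOpen_compl
      exact ⟨U, hU, hxU, fun hy => hUy hy rfl⟩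
  let := TopologicalSpace.metrizableSpaceMetric X
  have : Nonempty X := (OrderedBratteliDiagram.nonempty_pathSpace D.toBratteliDiagram).map φ.symm
  obtain ⟨C, hC, hCs⟩ := exists_clopen_enumeration (X := X)
  have hsep : ∀ x y, (∀ n, x ∈ C n ↔ y ∈ C n) → x = y := by
    intro x y h
    by_contra hxy
    obtain ⟨U, hU, hxU, hyU⟩ := exists_isClopen_of_totally_separated hxy
    obtain ⟨n, rfl⟩ := hCs U hU
    exact hyU ((h n).1 hxU)
  obtain ⟨A, hA⟩ := exists_isBasicSet f hC hsep
  obtain ⟨B, hB⟩ := hA.exists_isMinimalBasicSet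
  have hb := (isBasicSet_iff f B).1 hB.prop
  have hiter : ∀ (n : ℕ) (x : X), φ (f^[n] x) = ψ^[n] (φ x) := fun n x =>
    (Function.Semiconj.iterate_right hφ n).eq x
  have hint : (interior B).Subsingleton := by
    refine hB.subsingleton_interior (D.isClosed_maxPaths.preimage φ.continuous)
      (hD.subsingleton_interior hC hsep φ) fun x n hn hx => ?_
    rw [← iterate_eq_zpow] at hx
    obtain ⟨i, hi⟩ := hψ.exists_mem_maxPaths hn (p := φ x) (by rw [← hiter, hx])
    exact ⟨i, by rwa [← iterate_eq_zpow, mem_preimage, hiter]⟩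
  obtain ⟨U, hU0, hU, hanti, hUB⟩ := hb.1.exists_antitone_clopen
  have hm : ∀ n, MeetsOrbits f (U n) := fun n =>
    meetsOrbits_of_omegaLimitPoint_inter (hU n).isOpen fun x =>
      (hb.2.1 x).mono (inter_subset_inter_right _ (hUB ▸ iInter_subset U n))
  let T := TowerSystem.ofBases f U C hU0 hU hanti hm hC hsep
  have hpos : ∀ x, (∀ n, T.pos n x = 0) ↔ x ∈ B := fun x => by
    rw [← hUB, mem_iInter]
    exact forall_congr' fun n => lag_eq_zero_iff (hU n).isOpen (hm n)
  refine ⟨T.diagram, T.vershik, T.pathHomeo, B, T.isDecisive ?_, T.isBratteliVershikModel,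
    T.hasClosingProperty fun x hx k hk => ?_, fun x => (T.vershik_path x).symm, hB, ?_⟩
  · rwa [show {x | ∀ n, T.pos n x = 0} = B from Set.ext hpos]
  · rw [hpos] at hx hk
    rw [iterate_eq_zpow] at hk ⊢
    exact hb.2.2 x hx k hk
  · ext p
    obtain ⟨x, rfl⟩ := T.pathHomeo.surjective p
    rw [T.pathHomeo.injective.mem_set_image, ← hpos]
    exact T.path_mem_minPaths_iff.symm
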